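/- Let $\mathbb{F}_q$ be a finite field with $q$ elements, $K=\mathbb{F}_q(\theta)$ the rational function field with the absolute value $|a|=q^{\deg_\theta a}$, $K_\infty=\mathbb{F}_q((1/\theta))$ its completion, $C$ the completion of an algebraic closure of $K_\infty$ (for the unique extension of $|\cdot|$), and $K^{\mathrm{alg}}$ the algebraic closure of $K$ in $C$. Fix $\zeta\in C$ with $\zeta^{q-1}=-\theta$ and put $$\widetilde{\pi}=\theta\,\zeta\prod_{i=1}^{\infty}\bigl(1-\theta^{1-q^i}\bigr)^{-1}\in C,\qquad \Omega(t)=\zeta^{-q}\prod_{i=1}^{\infty}\Bigl(1-\frac{t}{\theta^{q^i}}\Bigr)\in C[[t]],\qquad L_0=-\Omega^{-1}.$$ For $\beta\in K^{\mathrm{alg}}$ with $|\beta|<q^{q/(q-1)}$ put $$\log_{\mathrm{Car}}\beta=\sum_{i\ge 0}\frac{(-1)^i\beta^{q^i}}{(\theta^{q^i}-\theta)(\theta^{q^{i-1}}-\theta)\cdots(\theta^{q}-\theta)}\in C,\qquad L_\beta(t)=\beta+\sum_{i=1}^{\infty}\frac{(-1)^i\beta^{q^i}}{(\theta^q-t)(\theta^{q^2}-t)\cdots(\theta^{q^i}-t)}\in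 C[[t]]$$ (sums and products of power series in $t$ converge coefficientwise). **Proposition.** Let $m\ge 0$ and let $\beta_1,\dots,\beta_m\in K^{\mathrm{alg}}$ satisfy $|\beta_i|<q^{q/(q-1)}$ for all $i$. If $L_0,L_{\beta_1},\dots,L_{\beta_m}$ are algebraically dependent over $K^{\mathrm{alg}}(t)$ (inside $C((t))$), then $\widetilde{\pi},\log_{\mathrm{Car}}\beta_1,\dots,\log_{\mathrm{Car}}\beta_m$ are linearly dependent over $K$. -/

import Mathlib

noncomputable section

namespace Carlitz

/-! ### The fields `K`, `K_∞`, `C` -/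

section Fields

variable (Fq : Type*) [Field Fq] [Fintype Fq]

/-- The cardinality `q` of the finite field of constants. -/
abbrev q : ℕ := Fintype.card Fq

lemma one_lt_q : 1 < q Fq := Fintype.one_lt_card

/-- The rational function field `K = 𝔽_q(θ)`; the variable `θ` is `RatFunc.X`. -/
abbrev K : Type _ := RatFunc Fq

open Classical in
/-- The absolute value `|a| = q ^ deg_θ a` on `K`. -/
def absInfty : AbsoluteValue (K Fq) ℝ where
  toFun a := if a = 0 then 0 else (q Fq : ℝ) ^ a.intDegree
  map_mul' a b := by
    have hq : (q Fq : ℝ) ≠ 0 := by have := one_lt_q Fq; positivity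
    by_cases ha : a = 0
    · simp [ha]
    by_cases hb : b = 0
    · simp [hb]
    simp [ha, hb, RatFunc.intDegree_mul ha hb, zpow_add₀ hq]
  nonneg' a := by split_ifs <;> positivity
  eq_zero' a := by
    have hq : (q Fq : ℝ) ≠ 0 := by have := one_lt_q Fq; positivity
    by_cases ha : a = 0
    · simp [ha]
    · simpa [ha] using zpow_ne_zero _ hq
  add_le' a b := by
    have hq : (1 : ℝ) ≤ q Fq := by exact_mod_cast (one_lt_q Fq).le
    by_cases ha : a = 0
    · simp [ha]
    by_cases hb : b = 0
    · simp [hb]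
    have hpa : (0 : ℝ) ≤ (q Fq : ℝ) ^ a.intDegree := by positivity
    have hpb : (0 : ℝ) ≤ (q Fq : ℝ) ^ b.intDegree := by positivity
    by_cases hab : a + b = 0
    · simp only [hab, ha, hb, if_true, if_false]; positivity
    · simp only [hab, ha, hb, if_false]
      rcases le_max_iff.mp (RatFunc.intDegree_add_le hb hab) with h | h
      · exact (zpow_le_zpow_right₀ hq h).trans (by linarith)
      · exact (zpow_le_zpow_right₀ hq h).trans (by linarith)

lemma absInfty_apply_of_ne_zero {a : K Fq} (ha : a ≠ 0) :
    absInfty Fq a = (q Fq : ℝ) ^ a.intDegree := by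
  simp [absInfty, ha]

lemma absInfty_X : absInfty Fq RatFunc.X = q Fq := by
  rw [absInfty_apply_of_ne_zero Fq RatFunc.X_ne_zero, RatFunc.intDegree_X, zpow_one]

lemma absInfty_add_le_max (a b : K Fq) :
    absInfty Fq (a + b) ≤ max (absInfty Fq a) (absInfty Fq b) := by
  have hq : (1 : ℝ) ≤ q Fq := by exact_mod_cast (one_lt_q Fq).le
  by_cases ha : a = 0
  · simp [ha]
  by_cases hb : b = 0
  · simp [hb]
  by_cases hab : a + b = 0
  · simp [hab]
  rw [absInfty_apply_of_ne_zero Fq ha, absInfty_apply_of_ne_zero Fq hb,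
    absInfty_apply_of_ne_zero Fq hab]
  rcases le_max_iff.mp (RatFunc.intDegree_add_le hb hab) with h | h
  · exact le_max_of_le_left (zpow_le_zpow_right₀ hq h)
  · exact le_max_of_le_right (zpow_le_zpow_right₀ hq h)

/-- `K_∞ = 𝔽_q((1/θ))`, the completion of `K` for `|·|`. -/
abbrev Kinfty : Type _ := (absInfty Fq).Completion

instance : IsUltrametricDist (Kinfty Fq) := by
  refine IsUltrametricDist.isUltrametricDist_of_forall_norm_add_le_max_norm fun x y => ?_
  induction x, y using UniformSpace.Completion.induction_on₂ with
  | hp => exact isClosed_le (by fun_prop) (by fun_prop)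
  | ih x y =>
    rw [← UniformSpace.Completion.coe_add]
    simp only [UniformSpace.Completion.norm_coe]
    exact absInfty_add_le_max Fq x.ofAbs y.ofAbs

lemma norm_algebraMap_Kinfty (a : K Fq) : ‖algebraMap (K Fq) (Kinfty Fq) a‖ = absInfty Fq a := by
  change ‖((algebraMap (K Fq) (WithAbs (absInfty Fq)) a : WithAbs (absInfty Fq)) : Kinfty Fq)‖ = _
  rw [UniformSpace.Completion.norm_coe]
  rfl

instance : NontriviallyNormedField (Kinfty Fq) where
  non_trivial := by
    refine ⟨algebraMap (K Fq) (Kinfty Fq) RatFunc.X, ?_⟩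
    rw [norm_algebraMap_Kinfty, absInfty_X]
    exact_mod_cast one_lt_q Fq

/-- An algebraic closure of `K_∞`, with the unique extension of `|·|` (the spectral norm). -/
abbrev KinftyAlg : Type _ := AlgebraicClosure (Kinfty Fq)

instance : NormedField (KinftyAlg Fq) := spectralNorm.normedField (Kinfty Fq) (KinftyAlg Fq)

instance : NormedAlgebra (Kinfty Fq) (KinftyAlg Fq) := spectralNorm.normedAlgebra _ _

instance : UniformContinuousConstSMul (Kinfty Fq) (KinftyAlg Fq) :=
  uniformContinuousConstSMul_of_continuousConstSMul _ _

instance : UniformContinuousConstSMul (K Fq) (KinftyAlg Fq) where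
  uniformContinuous_const_smul a := by
    have h : (fun x : KinftyAlg Fq => a • x) =
        fun x => (algebraMap (K Fq) (Kinfty Fq) a) • x := by
      funext x
      exact algebra_compatible_smul (Kinfty Fq) a x
    change UniformContinuous (fun x : KinftyAlg Fq => a • x)
    rw [h]
    exact uniformContinuous_const_smul _

/-- The field `C`, the completion of the algebraic closure of `K_∞`. -/
abbrev Cinfty : Type _ := UniformSpace.Completion (KinftyAlg Fq)

/-- The norm of `C` extends the absolute value of `K`; in particular `|θ| = q`. -/
lemma norm_algebraMap_Cinfty (a : K Fq) : ‖algebraMap (K Fq) (Cinfty Fq) a‖ = absInfty Fq a := by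
  have h := norm_algebraMap' (Cinfty Fq) (algebraMap (K Fq) (Kinfty Fq) a)
  rw [norm_algebraMap_Kinfty] at h
  exact h

/-- `K^alg`, the algebraic closure of `K` in `C`. -/
abbrev Kalg : IntermediateField (K Fq) (Cinfty Fq) := algebraicClosure (K Fq) (Cinfty Fq)

/-- Elements of `K^alg` act on `C((t))` as constants. -/
lemma algebraMap_Kalg_laurentSeries (a : Kalg Fq) :
    algebraMap (Kalg Fq) (LaurentSeries (Cinfty Fq)) a = HahnSeries.C (a : Cinfty Fq) := by
  change algebraMap (Cinfty Fq) (LaurentSeries (Cinfty Fq)) a = _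
  rw [HahnSeries.algebraMap_apply', PowerSeries.algebraMap_apply]
  exact HahnSeries.ofPowerSeries_C _

/-- The field `K^alg(t)` of rational functions, inside the field `C((t))` of formal Laurent
series. -/
abbrev KalgT : IntermediateField (Kalg Fq) (LaurentSeries (Cinfty Fq)) :=
  IntermediateField.adjoin (Kalg Fq) {(HahnSeries.single 1 1 : LaurentSeries (Cinfty Fq))}

end Fields

/-! ### The Carlitz period and logarithm, and their deformations -/

section Series

variable {Fq : Type*} [Field Fq] [Fintype Fq]

variable (Fq) in
/-- The element `θ` of `C`. -/
def theta : Cinfty Fq := algebraMap (K Fq) (Cinfty Fq) RatFunc.X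

/-- The Carlitz logarithm
`∑_{i ≥ 0} (-1)^i z^(q^i) / ((θ^(q^i) - θ) ⋯ (θ^q - θ))`, for `|z| < q^(q/(q-1))`. -/
def logCar (z : Cinfty Fq) : Cinfty Fq :=
  ∑' i : ℕ, (-1) ^ i * z ^ q Fq ^ i /
    ∏ j ∈ Finset.range i, (theta Fq ^ q Fq ^ (j + 1) - theta Fq)

/-- The fundamental period `θ ζ ∏_{i ≥ 1} (1 - θ^(1 - q^i))⁻¹` of the Carlitz module, where `ζ`
is a `(q-1)`-th root of `-θ`. -/
def piTilde (ζ : Cinfty Fq) : Cinfty Fq :=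
  theta Fq * ζ * ∏' i : ℕ, (1 - theta Fq ^ (1 - (q Fq : ℤ) ^ (i + 1)))⁻¹

open scoped PowerSeries.WithPiTopology in
/-- The formal series
`L_β(t) = ∑_{i ≥ 0} (-1)^i β^(q^i) / ((θ^q - t) ⋯ (θ^(q^i) - t))`, for `|β| < q^(q/(q-1))`.
The sum is taken in `C[[t]]` with the topology of coefficientwise convergence. -/
def Lser (β : Cinfty Fq) : PowerSeries (Cinfty Fq) :=
  ∑' i : ℕ, PowerSeries.C ((-1) ^ i * β ^ q Fq ^ i) *
    (∏ j ∈ Finset.range i, (PowerSeries.C (theta Fq ^ q Fq ^ (j + 1)) - PowerSeries.X))⁻¹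

open scoped PowerSeries.WithPiTopology in
/-- The formal series `Ω(t) = ζ^(-q) ∏_{i ≥ 1} (1 - t / θ^(q^i))`, where `ζ` is a `(q-1)`-th root
of `-θ`. The product is taken in `C[[t]]` with the topology of coefficientwise convergence. -/
def Omega (ζ : Cinfty Fq) : PowerSeries (Cinfty Fq) :=
  PowerSeries.C (ζ ^ q Fq)⁻¹ *
    ∏' i : ℕ, (1 - PowerSeries.C (theta Fq ^ q Fq ^ (i + 1))⁻¹ * PowerSeries.X)

/-- The formal series `L_0 = -Ω⁻¹`. -/
def Lzero (ζ : Cinfty Fq) : PowerSeries (Cinfty Fq) := -(Omega ζ)⁻¹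

end Series

end Carlitz

end

/-! Let `τ` raise the coefficients of a series in `t` to the power `q` and fix `t`. Shifting the
defining product and sums by one index gives `τ L_0 = (t - θ^q) L_0` and `τ L_β = (t - θ^q)(L_β -
β)` (`map_qFrob_Lzero`, `map_qFrob_Lser`), while evaluation at `t = θ` gives the period and the
logarithms (`evalSeries_Lzero`, `evalSeries_Lser`). It therefore suffices to find a relation `∑ d_i
L_i + N = 0` with `d_i` in `𝔽_q[t]` not all zero, `N` a polynomial over `K^alg`, and `N(θ) = 0`;
setting `t = θ` then finishes the proof.

An algebraic relation `P` yields such a linear one by a minimality argument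
(`exists_linear_relation`). Put `a = t - θ^q`. A suitable relation of least degree `n + 1` is an
eigenvector, with eigenvalue `a^(n+1)`, of the substitution on polynomials that mirrors `τ`. Each
partial derivative of `P`, evaluated at the series and divided by `L_0^n`, is `τ`-invariant, hence
rational, so by minimality it is an invariant `g_i` times `X_o^n`, where `X_o` is the variable of
`L_0`. Comparing coefficients of `X_o^n` gives `τ u = a (u + ∑ b_i g_i)` with `u` rational, and then
`∑ g_i L_i + u` is an invariant multiple of `L_0`. In characteristic `p` all relevant `g_i` might
vanish; this is excluded because `t` is a `p`-basis and `τ r = a^k r` has no nonzero rational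
solution for `k > 0`.

Invariants are rational (`exists_ratToLaurent_eq_of_mapLaurent_eq`) because their coefficients lie
in `𝔽_q`, up to a polynomial factor they are bounded on a disc of radius greater than `1`, and a
null sequence with values in a finite set is eventually zero. Finally `N(θ) = 0` holds because `τ N`
is divisible by `t - θ^q` and its value at `θ^q` is `N(θ)^q`. -/

namespace Carlitz

/-! ### Semilinear affine substitutions on polynomials. -/

section DifferenceOperator

variable {σ E F : Type*} [Field E] [Field F]

/-- The semilinear substitution `X i ↦ a (X i - b i)`, acting on coefficients through `τ`. -/
noncomputable def twistShift (τ : E →+* E) (a : E) (b : σ → E) :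
    MvPolynomial σ E →+* MvPolynomial σ E :=
  MvPolynomial.eval₂Hom (MvPolynomial.C.comp τ)
    fun i => MvPolynomial.C a * (MvPolynomial.X i - MvPolynomial.C (b i))

variable (τ : E →+* E) (a : E) (b : σ → E)

@[simp] lemma twistShift_C (c : E) :
    twistShift τ a b (MvPolynomial.C c) = MvPolynomial.C (τ c) := by
  simp [twistShift]

@[simp] lemma twistShift_X (i : σ) :
    twistShift τ a b (MvPolynomial.X i) =
      MvPolynomial.C a * (MvPolynomial.X i - MvPolynomial.C (b i)) := by
  simp [twistShift]

lemma eval₂_twistShift (j : E →+* F) (τF : F →+* F) (hj : ∀ e, τF (j e) = j (τ e))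
    (x : σ → F) (hx : ∀ i, τF (x i) = j a * (x i - j (b i))) (P : MvPolynomial σ E) :
    (twistShift τ a b P).eval₂ j x = τF (P.eval₂ j x) := by
  have : (MvPolynomial.eval₂Hom j x).comp (twistShift τ a b) =
      τF.comp (MvPolynomial.eval₂Hom j x) := by
    apply MvPolynomial.ringHom_ext
    · intro c; simp [hj]
    · intro i; simp [hx]
  exact congrArg (fun f => f P) this

/-- Chain rule for an affine substitution of slope `a`. The extra factor lowers an eigenvalue
`a^(n+1)` of `P` to `a^n` for its derivatives. -/
lemma pderiv_twistShift (i : σ) (P : MvPolynomial σ E) :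
    MvPolynomial.pderiv i (twistShift τ a b P) =
      MvPolynomial.C a * twistShift τ a b (MvPolynomial.pderiv i P) := by
  classical
  induction P using MvPolynomial.induction_on with
  | C c => simp
  | add p q hp hq => simp [hp, hq, mul_add]
  | mul_X p k hp =>
    simp only [map_mul, twistShift_X, MvPolynomial.pderiv_mul, hp, map_add,
      map_sub, MvPolynomial.pderiv_C, MvPolynomial.pderiv_X, sub_zero]
    by_cases h : i = k
    · subst h; simp; ring
    · simp [Ne.symm h]; ring

lemma coeff_pderiv_monomial_of_degree_le (i : σ) (μ ν : σ →₀ ℕ) (c : E)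
    (h : μ.degree ≤ ν.degree) :
    (MvPolynomial.pderiv i (MvPolynomial.monomial μ c)).coeff ν = 0 := by
  classical
  rw [MvPolynomial.coeff_pderiv, MvPolynomial.coeff_monomial, if_neg, zero_mul]
  rintro rfl
  simp at h

variable [Fintype σ]

/-- First-order Taylor expansion in the shift `b`: the bound on `n` leaves no room for terms of
second order in `b`. The induction splits off one variable at a time. -/
lemma coeff_twistShift_monomial (n : ℕ) : ∀ μ ν : σ →₀ ℕ, μ.degree = n → n ≤ ν.degree + 1 →
    (twistShift τ a b (MvPolynomial.monomial μ 1)).coeff ν =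
      a ^ ν.degree * (MvPolynomial.monomial μ 1 : MvPolynomial σ E).coeff ν -
        a ^ (ν.degree + 1) * ∑ i, b i *
          (MvPolynomial.pderiv i (MvPolynomial.monomial μ 1)).coeff ν := by
  classical
  induction n with
  | zero =>
    intro μ ν hμ _
    rw [Finsupp.degree_eq_zero_iff] at hμ
    subst hμ
    have h1 : (MvPolynomial.monomial (0 : σ →₀ ℕ) (1 : E)) = 1 := rfl
    rw [h1, map_one]
    by_cases hν : ν = 0
    · subst hν; simp
    · simp [MvPolynomial.coeff_one, Ne.symm hν]
  | succ n ih =>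
    intro μ ν hμ hν
    obtain ⟨k, hk⟩ : ∃ k, μ k ≠ 0 := by
      by_contra! h
      have : μ = 0 := Finsupp.ext h
      simp [this] at hμ
    obtain ⟨μ', rfl⟩ : ∃ μ', μ = μ' + Finsupp.single k 1 :=
      ⟨μ - Finsupp.single k 1, (tsub_add_cancel_of_le (by
        simpa [Finsupp.single_le_iff] using Nat.one_le_iff_ne_zero.mpr hk)).symm⟩
    have hμ' : μ'.degree = n := by simpa using hμ
    have hm : (MvPolynomial.monomial (μ' + Finsupp.single k 1) (1 : E)) =
        MvPolynomial.monomial μ' 1 * MvPolynomial.X k := by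
      rw [MvPolynomial.X, MvPolynomial.monomial_mul, one_mul]
    rw [hm, map_mul, twistShift_X]
    have e1 : twistShift τ a b (MvPolynomial.monomial μ' 1) *
        (MvPolynomial.C a * (MvPolynomial.X k - MvPolynomial.C (b k))) =
        MvPolynomial.C a * (twistShift τ a b (MvPolynomial.monomial μ' 1) * MvPolynomial.X k) -
        MvPolynomial.C (a * b k) * twistShift τ a b (MvPolynomial.monomial μ' 1) := by
      rw [map_mul]; ring
    rw [e1, MvPolynomial.coeff_sub, MvPolynomial.coeff_C_mul, MvPolynomial.coeff_C_mul,
      ih μ' ν hμ' (by omega)]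
    -- Here `μ'` has degree at most that of `ν`, so multiplying by `b k` creates no second-order
    -- term.
    have h0 : ∀ i, (MvPolynomial.pderiv i (MvPolynomial.monomial μ' (1 : E))).coeff ν = 0 :=
      fun i => coeff_pderiv_monomial_of_degree_le i μ' ν 1 (by omega)
    simp only [h0, mul_zero, Finset.sum_const_zero, sub_zero, MvPolynomial.pderiv_mul,
      MvPolynomial.coeff_add, MvPolynomial.coeff_mul_X', mul_add, Finset.sum_add_distrib]
    have e2 : ∑ i, b i * (MvPolynomial.monomial μ' (1 : E) *
        MvPolynomial.pderiv i (MvPolynomial.X k)).coeff ν =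
        b k * (MvPolynomial.monomial μ' (1 : E)).coeff ν := by
      rw [Finset.sum_eq_single k]
      · simp
      · intro i _ hi
        rw [MvPolynomial.pderiv_X_of_ne (Ne.symm hi)]; simp
      · simp
    rw [e2]
    by_cases hk' : k ∈ ν.support
    · obtain ⟨ν', rfl⟩ : ∃ ν', ν = ν' + Finsupp.single k 1 :=
        ⟨ν - Finsupp.single k 1, (tsub_add_cancel_of_le (by
          simpa [Finsupp.single_le_iff] using
            Nat.one_le_iff_ne_zero.mpr (Finsupp.mem_support_iff.mp hk'))).symm⟩
      have hd : (ν' + Finsupp.single k 1).degree = ν'.degree + 1 := by simp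
      simp only [hk', if_true, add_tsub_cancel_right]
      rw [ih μ' ν' hμ' (by omega), hd]
      ring
    · simp only [hk', if_false]
      simp
      ring_nf

lemma coeff_twistShift (P : MvPolynomial σ E) (ν : σ →₀ ℕ) (h : P.totalDegree ≤ ν.degree + 1) :
    (twistShift τ a b P).coeff ν = a ^ ν.degree * τ (P.coeff ν) -
      a ^ (ν.degree + 1) * ∑ i, b i * τ ((MvPolynomial.pderiv i P).coeff ν) := by
  classical
  have key : ∀ s : Finset (σ →₀ ℕ), (∀ μ ∈ s, μ.degree ≤ ν.degree + 1) → ∀ c : (σ →₀ ℕ) → E,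
      (twistShift τ a b (∑ μ ∈ s, MvPolynomial.monomial μ (c μ))).coeff ν =
        a ^ ν.degree * τ ((∑ μ ∈ s, MvPolynomial.monomial μ (c μ)).coeff ν) -
        a ^ (ν.degree + 1) * ∑ i, b i *
          τ ((MvPolynomial.pderiv i (∑ μ ∈ s, MvPolynomial.monomial μ (c μ))).coeff ν) := by
    intro s
    induction s using Finset.induction_on with
    | empty => intro _ c; simp
    | insert μ s hμ ih =>
      intro hs c
      rw [Finset.sum_insert hμ, map_add, MvPolynomial.coeff_add,
        ih (fun μ' h' => hs μ' (Finset.mem_insert_of_mem h')) c]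
      have hc : MvPolynomial.monomial μ (c μ) =
          MvPolynomial.C (c μ) * MvPolynomial.monomial μ 1 := by
        rw [MvPolynomial.C_mul_monomial, mul_one]
      -- These coefficients are natural numbers, hence fixed by `τ`.
      have hτ1 : ∀ i, τ ((MvPolynomial.pderiv i (MvPolynomial.monomial μ (1 : E))).coeff ν) =
          (MvPolynomial.pderiv i (MvPolynomial.monomial μ (1 : E))).coeff ν := by
        intro i
        rw [MvPolynomial.coeff_pderiv, MvPolynomial.coeff_monomial]
        split_ifs <;> simp
      have hτ0 : τ ((MvPolynomial.monomial μ (1 : E)).coeff ν) =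
          (MvPolynomial.monomial μ (1 : E)).coeff ν := by
        rw [MvPolynomial.coeff_monomial]
        split_ifs <;> simp
      rw [hc, map_mul, twistShift_C, MvPolynomial.coeff_C_mul,
        coeff_twistShift_monomial τ a b _ μ ν rfl (hs μ (Finset.mem_insert_self _ _))]
      simp only [map_add, MvPolynomial.coeff_add, MvPolynomial.coeff_C_mul,
        MvPolynomial.pderiv_C_mul, map_mul, hτ1, hτ0, mul_add, Finset.sum_add_distrib]
      simp only [mul_left_comm _ (τ (c μ)), ← Finset.mul_sum]
      ring
  have := key P.support (fun μ hμ => (MvPolynomial.le_totalDegree hμ).trans h) P.coeff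
  rwa [MvPolynomial.support_sum_monomial_coeff] at this

lemma coeff_twistShift_of_totalDegree_le (P : MvPolynomial σ E) (ν : σ →₀ ℕ)
    (h : P.totalDegree ≤ ν.degree) :
    (twistShift τ a b P).coeff ν = a ^ ν.degree * τ (P.coeff ν) := by
  rw [coeff_twistShift τ a b P ν (by omega), Finset.sum_eq_zero, mul_zero, sub_zero]
  intro i _
  rw [MvPolynomial.coeff_pderiv, MvPolynomial.coeff_eq_zero_of_totalDegree_lt]
  · simp
  · change _ < (ν + Finsupp.single i 1).degree
    simp; omega

end DifferenceOperator

/-! ### From a minimal algebraic relation to a linear one. -/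

section DifferenceRelation

variable {σ E F : Type*} [Field E] [Field F] (j : E →+* F) (x : σ → F)

/-- In characteristic `p`, the exponents of a polynomial with vanishing derivatives are divisible
by `p`. -/
lemma dvd_of_pderiv_eq_zero (p : ℕ) [CharP E p] (P : MvPolynomial σ E)
    (hall : ∀ i, MvPolynomial.pderiv i P = 0) : ∀ μ ∈ P.support, ∀ i, p ∣ μ i := by
  classical
  intro μ hμ i
  by_cases hi : μ i = 0
  · simp [hi]
  have h1 := congrArg (MvPolynomial.coeff (μ - Finsupp.single i 1)) (hall i)
  rw [MvPolynomial.coeff_pderiv, tsub_add_cancel_of_le (by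
    simpa [Finsupp.single_le_iff] using Nat.one_le_iff_ne_zero.mpr hi), MvPolynomial.coeff_zero,
    mul_eq_zero] at h1
  have h2 := h1.resolve_left (MvPolynomial.mem_support_iff.mp hμ)
  rw [← CharP.cast_eq_zero_iff E p]
  simp only [Finsupp.tsub_apply, Finsupp.single_eq_same] at h2
  rw [← Nat.cast_succ, Nat.succ_eq_add_one, Nat.sub_add_cancel
    (Nat.one_le_iff_ne_zero.mpr hi)] at h2
  exact h2

lemma totalDegree_pos_of_eval₂_eq_zero (P : MvPolynomial σ E) (hP0 : P ≠ 0)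
    (hP : P.eval₂ j x = 0) : 0 < P.totalDegree := by
  rw [Nat.pos_iff_ne_zero]
  intro h
  rw [MvPolynomial.totalDegree_eq_zero_iff_eq_C] at h
  rw [h, MvPolynomial.eval₂_C, map_eq_zero] at hP
  rw [hP, map_zero] at h
  exact hP0 h

lemma exists_mem_support_degree_eq (P : MvPolynomial σ E) (hP : P ≠ 0) :
    ∃ μ ∈ P.support, μ.degree = P.totalDegree := by
  obtain ⟨μ, hμ, h⟩ := Finset.exists_mem_eq_sup P.support
    (MvPolynomial.support_nonempty.mpr hP) (fun μ => μ.sum fun _ e => e)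
  exact ⟨μ, hμ, h.symm⟩

/-- In characteristic `p`, if `t` is a `p`-basis of both `E` and `F`, then an algebraic relation of
minimal total degree is not a polynomial in `p`-th powers. -/
lemma exists_pderiv_ne_zero (p : ℕ) [Fact p.Prime] [CharP E p] (t : E)
    (hE : ∀ e : E, ∃ c : ℕ → E, e = ∑ k ∈ Finset.range p, t ^ k * c k ^ p)
    (hF : ∀ w : ℕ → F, ∑ k ∈ Finset.range p, j t ^ k * w k ^ p = 0 →
      ∀ k ∈ Finset.range p, w k = 0)
    (P : MvPolynomial σ E) (hP0 : P ≠ 0) (hP : P.eval₂ j x = 0)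
    (hmin : ∀ Q : MvPolynomial σ E, Q ≠ 0 → Q.eval₂ j x = 0 → P.totalDegree ≤ Q.totalDegree) :
    ∃ i, MvPolynomial.pderiv i P ≠ 0 := by
  classical
  have hp : p.Prime := Fact.out
  by_contra! hall
  have hdvd := dvd_of_pderiv_eq_zero p P hall
  have hdiv : ∀ μ ∈ P.support, p • μ.mapRange (· / p) (Nat.zero_div p) = μ := by
    intro μ hμ
    ext i
    simpa using Nat.mul_div_cancel' (hdvd μ hμ i)
  choose c hc using hE
  -- Dividing all exponents by `p` and splitting each coefficient along the `p`-basis gives `P = ∑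
  -- t^k Q_k^p`. Independence of the `t^k` makes every `Q_k` a relation, of degree at most `deg P /
  -- p`.
  let Q : ℕ → MvPolynomial σ E := fun k =>
    ∑ μ ∈ P.support, MvPolynomial.monomial (μ.mapRange (· / p) (Nat.zero_div p))
      (c (P.coeff μ) k)
  have hQp : ∀ k, Q k ^ p = ∑ μ ∈ P.support, MvPolynomial.monomial μ (c (P.coeff μ) k ^ p) := by
    intro k
    rw [sum_pow_char]
    refine Finset.sum_congr rfl fun μ hμ => ?_
    rw [MvPolynomial.monomial_pow]
    rw [hdiv μ hμ]
  have hPQ : P = ∑ k ∈ Finset.range p, MvPolynomial.C (t ^ k) * Q k ^ p := by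
    simp_rw [hQp, Finset.mul_sum, MvPolynomial.C_mul_monomial]
    rw [Finset.sum_comm]
    conv_lhs => rw [← MvPolynomial.support_sum_monomial_coeff P]
    refine Finset.sum_congr rfl fun μ _ => ?_
    rw [← map_sum, ← hc]
  have hQ0 : ∀ k ∈ Finset.range p, (Q k).eval₂ j x = 0 := by
    apply hF
    rw [← hP]
    conv_rhs => rw [hPQ]
    rw [MvPolynomial.eval₂_sum]
    simp [MvPolynomial.eval₂_mul, MvPolynomial.eval₂_pow]
  obtain ⟨k, hk, hQk⟩ : ∃ k ∈ Finset.range p, Q k ≠ 0 := by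
    by_contra! h
    apply hP0
    rw [hPQ]
    exact Finset.sum_eq_zero fun k hk => by simp [h k hk, hp.ne_zero]
  have hle := hmin _ hQk (hQ0 k hk)
  have hpos := totalDegree_pos_of_eval₂_eq_zero j x P hP0 hP
  have hlt : (Q k).totalDegree ≤ P.totalDegree / p := by
    refine (MvPolynomial.totalDegree_finsetSum _ _).trans (Finset.sup_le fun μ hμ => ?_)
    refine (MvPolynomial.totalDegree_monomial_le _ _).trans ?_
    rw [Nat.le_div_iff_mul_le hp.pos, mul_comm]
    change p * Finsupp.degree _ ≤ _
    rw [← smul_eq_mul, ← map_nsmul, hdiv μ hμ]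
    exact MvPolynomial.le_totalDegree hμ
  exact (hlt.trans_lt (Nat.div_lt_self hpos hp.one_lt)).not_ge hle

variable [Fintype σ] (τ : E →+* E) (τF : F →+* F) (hj : ∀ e, τF (j e) = j (τ e)) (a : E)
  (b : σ → E) (hx : ∀ i, τF (x i) = j a * (x i - j (b i)))
include hj hx

/-- A relation of minimal total degree can be chosen to be an eigenvector of the semilinear
substitution `twistShift`. -/
lemma exists_twistShift_eigenvector (hdep : ∃ P : MvPolynomial σ E, P ≠ 0 ∧ P.eval₂ j x = 0) :
    ∃ P : MvPolynomial σ E, P ≠ 0 ∧ P.eval₂ j x = 0 ∧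
      (∀ Q : MvPolynomial σ E, Q ≠ 0 → Q.eval₂ j x = 0 → P.totalDegree ≤ Q.totalDegree) ∧
      twistShift τ a b P = MvPolynomial.C (a ^ P.totalDegree) * P := by
  classical
  obtain ⟨P₀, ⟨hP₀, hP₀x⟩, hmin₀⟩ := exists_minimalFor_of_wellFoundedLT
    (fun P : MvPolynomial σ E => P ≠ 0 ∧ P.eval₂ j x = 0) (fun P => P.totalDegree) hdep
  have hmin : ∀ Q : MvPolynomial σ E, Q ≠ 0 → Q.eval₂ j x = 0 →
      P₀.totalDegree ≤ Q.totalDegree := fun Q h1 h2 =>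
    (le_total P₀.totalDegree Q.totalDegree).elim id fun h => hmin₀ ⟨h1, h2⟩ h
  set d := P₀.totalDegree with hd
  -- Second minimality condition: the fewest monomials of top degree among relations of least
  -- degree.
  let N : MvPolynomial σ E → ℕ := fun P => (P.support.filter fun μ => μ.degree = d).card
  obtain ⟨P₁, ⟨hP₁, hP₁x, hP₁d⟩, hminN⟩ := exists_minimalFor_of_wellFoundedLT
    (fun P : MvPolynomial σ E => P ≠ 0 ∧ P.eval₂ j x = 0 ∧ P.totalDegree = d) N
    ⟨P₀, hP₀, hP₀x, rfl⟩
  obtain ⟨μ, hμ, hμd⟩ := exists_mem_support_degree_eq P₁ hP₁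
  rw [hP₁d] at hμd
  have hμ0 : P₁.coeff μ ≠ 0 := MvPolynomial.mem_support_iff.mp hμ
  -- Normalised so that the coefficient at `μ` is `1`, which `τ` fixes; the monomial `μ` then
  -- cancels in `Q` below, and no new top-degree monomial appears.
  set P := MvPolynomial.C (P₁.coeff μ)⁻¹ * P₁ with hPdef
  have hcoeff : ∀ ν, P.coeff ν = (P₁.coeff μ)⁻¹ * P₁.coeff ν := fun ν => by
    rw [hPdef, MvPolynomial.coeff_C_mul]
  have hsupp : P.support = P₁.support := by
    ext ν
    simp [MvPolynomial.mem_support_iff, hcoeff, hμ0]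
  have hPd : P.totalDegree = d := by
    rw [← hP₁d, MvPolynomial.totalDegree, MvPolynomial.totalDegree, hsupp]
  have hPx : P.eval₂ j x = 0 := by rw [hPdef, MvPolynomial.eval₂_mul, hP₁x, mul_zero]
  have hP0 : P ≠ 0 := by
    rw [← MvPolynomial.support_nonempty, hsupp, MvPolynomial.support_nonempty]; exact hP₁
  refine ⟨P, hP0, hPx, by rw [hPd]; exact hmin, ?_⟩
  rw [hPd, ← sub_eq_zero]
  by_contra hQ0
  set Q := twistShift τ a b P - MvPolynomial.C (a ^ d) * P with hQ
  have hQcoeff : ∀ ν : σ →₀ ℕ, d ≤ ν.degree →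
      Q.coeff ν = a ^ ν.degree * τ (P.coeff ν) - a ^ d * P.coeff ν := by
    intro ν hν
    rw [hQ, MvPolynomial.coeff_sub, MvPolynomial.coeff_C_mul,
      coeff_twistShift_of_totalDegree_le τ a b P ν (hPd.trans_le hν)]
  have hgt : ∀ ν : σ →₀ ℕ, d < ν.degree → P.coeff ν = 0 := fun ν hν =>
    MvPolynomial.coeff_eq_zero_of_totalDegree_lt (hPd.trans_lt hν)
  have hQx : Q.eval₂ j x = 0 := by
    rw [hQ, MvPolynomial.eval₂_sub, MvPolynomial.eval₂_mul, hPx,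
      eval₂_twistShift τ a b j τF hj x hx, hPx]
    simp
  have hQd : Q.totalDegree ≤ d := by
    refine Finset.sup_le fun ν hν => ?_
    by_contra! hlt
    change d < ν.degree at hlt
    rw [MvPolynomial.mem_support_iff, hQcoeff ν hlt.le, hgt ν hlt] at hν
    simp at hν
  have hsub : (Q.support.filter fun μ => μ.degree = d) ⊂
      P₁.support.filter fun μ => μ.degree = d := by
    rw [Finset.ssubset_iff_of_subset]
    · refine ⟨μ, Finset.mem_filter.mpr ⟨hμ, hμd⟩, fun h => ?_⟩
      have h1 := MvPolynomial.mem_support_iff.mp (Finset.mem_filter.mp h).1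
      rw [hQcoeff μ hμd.ge, hcoeff, inv_mul_cancel₀ hμ0, hμd, map_one, sub_self] at h1
      exact h1 rfl
    · intro ν hν
      obtain ⟨h1, h2⟩ := Finset.mem_filter.mp hν
      refine Finset.mem_filter.mpr ⟨?_, h2⟩
      rw [← hsupp]
      rw [MvPolynomial.mem_support_iff, hQcoeff ν h2.ge] at h1
      rw [MvPolynomial.mem_support_iff]
      intro h0
      simp [h0] at h1
  have hcard := Finset.card_lt_card hsub
  exact hcard.not_ge (hminN ⟨hQ0, hQx, le_antisymm hQd (hmin Q hQ0 hQx)⟩ hcard.le)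

/-- **Algebraic relations between solutions of affine difference equations are linear.**
Let `x o ≠ 0` be a solution of `τ x = a x` and let `x i` be solutions of `τ x = a (x - b i)`. If these
are algebraically dependent over `E`, then a nontrivial combination of the equations with constant
coefficients has a solution `-u` in `E`. -/
theorem exists_linear_relation (p : ℕ) [Fact p.Prime] [CharP E p] (t : E)
    (hE : ∀ e : E, ∃ c : ℕ → E, e = ∑ k ∈ Finset.range p, t ^ k * c k ^ p)
    (hF : ∀ w : ℕ → F, ∑ k ∈ Finset.range p, j t ^ k * w k ^ p = 0 →
      ∀ k ∈ Finset.range p, w k = 0)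
    (ha : a ≠ 0) (o : σ) (hbo : b o = 0) (hxo : x o ≠ 0)
    (hfix : ∀ (g : F) (k : ℕ) (P : MvPolynomial σ E), τF g = g →
      g * x o ^ k = P.eval₂ j x → ∃ e, j e = g)
    (heig : ∀ (u : E) (k : ℕ), 0 < k → τ u = a ^ k * u → u = 0)
    (hdep : ∃ P : MvPolynomial σ E, P ≠ 0 ∧ P.eval₂ j x = 0) :
    ∃ (c : σ → E) (u : E), (∃ i, i ≠ o ∧ c i ≠ 0) ∧ (∀ i, τ (c i) = c i) ∧
      τ u = a * (u + ∑ i, b i * c i) := by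
  classical
  obtain ⟨P, hP0, hPx, hmin, hT⟩ := exists_twistShift_eigenvector j x τ τF hj a b hx hdep
  have hpos := totalDegree_pos_of_eval₂_eq_zero j x P hP0 hPx
  obtain ⟨n, hn⟩ : ∃ n, P.totalDegree = n + 1 := ⟨P.totalDegree - 1, by omega⟩
  rw [hn] at hT
  have hCa : (MvPolynomial.C a : MvPolynomial σ E) ≠ 0 := by simpa using ha
  have hτo : τF (x o) = j a * x o := by rw [hx, hbo]; simp
  have hder : ∀ i, ∃ g, τ g = g ∧
      MvPolynomial.pderiv i P = MvPolynomial.C g * MvPolynomial.X o ^ n := by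
    intro i
    have h1 : twistShift τ a b (MvPolynomial.pderiv i P) =
        MvPolynomial.C (a ^ n) * MvPolynomial.pderiv i P := by
      apply mul_left_cancel₀ hCa
      rw [← pderiv_twistShift, hT, MvPolynomial.pderiv_C_mul, pow_succ', map_mul, mul_assoc]
    have h2 : τF ((MvPolynomial.pderiv i P).eval₂ j x) =
        j a ^ n * (MvPolynomial.pderiv i P).eval₂ j x := by
      rw [← eval₂_twistShift τ a b j τF hj x hx, h1, MvPolynomial.eval₂_mul,
        MvPolynomial.eval₂_C, map_pow]
    have hja : j a ≠ 0 := by simpa using ha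
    -- Numerator and denominator are both multiplied by `a^n` under `τF`, so the quotient is
    -- invariant.
    obtain ⟨g, hg⟩ := hfix ((MvPolynomial.pderiv i P).eval₂ j x / x o ^ n) n
      (MvPolynomial.pderiv i P) (by
        rw [map_div₀, h2, map_pow, hτo, mul_pow, mul_div_mul_left _ _ (pow_ne_zero _ hja)])
      (div_mul_cancel₀ _ (pow_ne_zero _ hxo))
    refine ⟨g, j.injective ?_, ?_⟩
    · rw [← hj, hg, map_div₀, h2, map_pow, hτo, mul_pow,
        mul_div_mul_left _ _ (pow_ne_zero _ hja)]
    · by_contra hne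
      -- The difference is a relation of degree at most `n`, below the minimal degree `n + 1`.
      have h3 := hmin _ (sub_ne_zero.mpr hne) (by
        rw [MvPolynomial.eval₂_sub, MvPolynomial.eval₂_mul, MvPolynomial.eval₂_C,
          MvPolynomial.eval₂_pow, MvPolynomial.eval₂_X, hg,
          div_mul_cancel₀ _ (pow_ne_zero _ hxo), sub_self])
      rw [hn] at h3
      have h4 : (MvPolynomial.pderiv i P).totalDegree ≤ n := by
        refine Finset.sup_le fun ν hν => ?_
        rw [MvPolynomial.mem_support_iff, MvPolynomial.coeff_pderiv] at hν
        have h5 := MvPolynomial.le_totalDegree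
          (MvPolynomial.mem_support_iff.mpr (left_ne_zero_of_mul hν))
        change (ν + Finsupp.single i 1).degree ≤ _ at h5
        change ν.degree ≤ n
        simp only [map_add, Finsupp.degree_single] at h5
        omega
      have h5 : (MvPolynomial.C g * MvPolynomial.X o ^ n).totalDegree ≤ n := by
        refine (MvPolynomial.totalDegree_mul _ _).trans ?_
        simp
      have h6 := MvPolynomial.totalDegree_sub (MvPolynomial.pderiv i P)
        (MvPolynomial.C g * MvPolynomial.X o ^ n)
      have h7 := max_le h4 h5
      omega
  choose g hτg hg using hder
  have hcg : ∀ i, (MvPolynomial.pderiv i P).coeff (Finsupp.single o n) = g i := by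
    intro i
    rw [hg, MvPolynomial.coeff_C_mul, MvPolynomial.coeff_X_pow, if_pos rfl, mul_one]
  by_cases hA : ∃ i, i ≠ o ∧ g i ≠ 0
  · refine ⟨g, P.coeff (Finsupp.single o n), hA, hτg, ?_⟩
    -- Comparing coefficients of `X_o^n` in the eigenvector equation brings in `P` one degree below
    -- the top together with its derivatives `g i`; this is the equation for `u`.
    have h1 := coeff_twistShift τ a b P (Finsupp.single o n) (by simp [hn])
    rw [hT, MvPolynomial.coeff_C_mul] at h1
    simp only [Finsupp.degree_single, hcg, hτg] at h1
    have h2 : a ^ n ≠ 0 := pow_ne_zero _ ha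
    apply mul_left_cancel₀ h2
    linear_combination -h1
  · exfalso
    push Not at hA
    set h := P.coeff (Finsupp.single o (n + 1)) with hh
    -- As `g o` turns out to be nonzero, so is `h`, and `p` does not divide `n + 1`.
    have hgo : g o = h * (n + 1 : ℕ) := by
      rw [← hcg o, MvPolynomial.coeff_pderiv, ← Finsupp.single_add]
      simp [hh]
    have hgo0 : g o ≠ 0 := by
      obtain ⟨i, hi⟩ := exists_pderiv_ne_zero j x p t hE hF P hP0 hPx hmin
      by_cases hio : i = o
      · intro h0
        rw [hg, hio, h0] at hi
        simp at hi
      · rw [hg, hA i hio] at hi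
        simp at hi
    have hh0 : h ≠ 0 := fun h0 => hgo0 (by rw [hgo, h0, zero_mul])
    have hn0 : ((n + 1 : ℕ) : E) ≠ 0 := fun h0 => hgo0 (by rw [hgo, h0, mul_zero])
    have hτh : τ h = h := by
      have h1 := coeff_twistShift_of_totalDegree_le τ a b P (Finsupp.single o (n + 1)) (by simp [hn])
      rw [hT, MvPolynomial.coeff_C_mul, Finsupp.degree_single] at h1
      exact (mul_left_cancel₀ (pow_ne_zero _ ha) h1).symm
    -- Removing this invariant monomial keeps the eigenvector equation and kills all derivatives.
    -- `R` is nonzero because `h x_o^(n+1) ≠ 0`, so all its exponents are divisible by `p`.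
    set R := P - MvPolynomial.C h * MvPolynomial.X o ^ (n + 1) with hR
    have hTR : twistShift τ a b R = MvPolynomial.C (a ^ (n + 1)) * R := by
      rw [hR, map_sub, hT, map_mul, twistShift_C, map_pow (twistShift τ a b), twistShift_X, hτh, hbo,
        map_zero, sub_zero, mul_pow, map_pow]
      ring
    have hRd : ∀ i, MvPolynomial.pderiv i R = 0 := by
      intro i
      rw [hR, map_sub, hg, MvPolynomial.pderiv_C_mul, MvPolynomial.pderiv_pow]
      by_cases hio : i = o
      · subst hio
        rw [hgo, MvPolynomial.pderiv_X_self, map_mul, map_natCast]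
        simp only [Nat.add_sub_cancel]
        ring
      · rw [hA i hio, MvPolynomial.pderiv_X_of_ne (Ne.symm hio)]
        simp
    have hR0 : R ≠ 0 := by
      intro h0
      rw [hR, sub_eq_zero] at h0
      rw [h0, MvPolynomial.eval₂_mul, MvPolynomial.eval₂_C, MvPolynomial.eval₂_pow,
        MvPolynomial.eval₂_X] at hPx
      exact mul_ne_zero (by simpa using hh0) (pow_ne_zero _ hxo) hPx
    have hRn : R.totalDegree ≤ n + 1 := by
      refine (MvPolynomial.totalDegree_sub _ _).trans (max_le hn.le ?_)
      refine (MvPolynomial.totalDegree_mul _ _).trans ?_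
      simp
    obtain ⟨μ, hμ, hμd⟩ := exists_mem_support_degree_eq R hR0
    have hr := MvPolynomial.mem_support_iff.mp hμ
    -- In degree below `n + 1` a top coefficient `r` satisfies `τ r = a^k r` with `k > 0`; in degree
    -- `n + 1`, `p` would divide `n + 1`.
    rcases hRn.lt_or_eq with hlt | heq
    · have h1 := coeff_twistShift_of_totalDegree_le τ a b R μ hμd.ge
      rw [hTR, MvPolynomial.coeff_C_mul, hμd] at h1
      refine hr (heig _ (n + 1 - R.totalDegree) (by omega) ?_)
      apply mul_left_cancel₀ (pow_ne_zero R.totalDegree ha)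
      rw [← h1, ← mul_assoc, ← pow_add, Nat.add_sub_cancel' hRn]
    · apply hn0
      rw [CharP.cast_eq_zero_iff E p, ← heq, ← hμd, Finsupp.degree_eq_sum]
      exact Finset.dvd_sum fun i _ => dvd_of_pderiv_eq_zero p R hRd μ hμ i

end DifferenceRelation

/-! ### Roots, Frobenius and constants in extensions of `K`. -/

section FieldFacts

variable (Fq : Type*) [Field Fq] [Fintype Fq]

instance : IsUltrametricDist (KinftyAlg Fq) :=
  IsUltrametricDist.isUltrametricDist_of_forall_norm_add_le_max_norm
    (isNonarchimedean_spectralNorm (K := Kinfty Fq) (L := KinftyAlg Fq))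

instance : IsUltrametricDist (Cinfty Fq) := by
  refine IsUltrametricDist.isUltrametricDist_of_forall_norm_add_le_max_norm fun x y => ?_
  induction x, y using UniformSpace.Completion.induction_on₂ with
  | hp => exact isClosed_le (by fun_prop) (by fun_prop)
  | ih x y =>
    rw [← UniformSpace.Completion.coe_add]
    simp only [UniformSpace.Completion.norm_coe]
    exact IsUltrametricDist.norm_add_le_max x y

variable {Fq} in
-- The minimal polynomial already splits in the algebraic closure of `K_∞`, so completing adds no
-- root. This makes `K^alg` perfect without using that `C` is algebraically closed.
lemma exists_coe_eq_of_isAlgebraic {z : Cinfty Fq} (hz : IsAlgebraic (K Fq) z) :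
    ∃ y : KinftyAlg Fq, (y : Cinfty Fq) = z := by
  have hs := IsAlgClosed.splits ((minpoly (K Fq) z).map (algebraMap (K Fq) (KinftyAlg Fq)))
  have h0 : (minpoly (K Fq) z).map (algebraMap (K Fq) (KinftyAlg Fq)) ≠ 0 :=
    (Polynomial.map_ne_zero_iff (algebraMap (K Fq) (KinftyAlg Fq)).injective).mpr
      (minpoly.ne_zero hz.isIntegral)
  refine hs.mem_range_of_isRoot h0 (i := algebraMap (KinftyAlg Fq) (Cinfty Fq)) (x := z) ?_
  rw [Polynomial.map_map, ← IsScalarTower.algebraMap_eq, Polynomial.IsRoot,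
    Polynomial.eval_map_algebraMap, minpoly.aeval]

variable {Fq} in
/-- `K^alg` is closed under taking roots. -/
lemma exists_pow_eq_Kalg {n : ℕ} (hn : 0 < n) (z : Kalg Fq) : ∃ w : Kalg Fq, w ^ n = z := by
  obtain ⟨y, hy⟩ := exists_coe_eq_of_isAlgebraic (mem_algebraicClosure_iff.mp z.2)
  obtain ⟨w, hw⟩ := IsAlgClosed.exists_pow_nat_eq y hn
  have hwz : (algebraMap (KinftyAlg Fq) (Cinfty Fq) w) ^ n = z := by
    rw [← map_pow, hw]; exact hy
  refine ⟨⟨algebraMap _ _ w, mem_algebraicClosure_iff.mpr ?_⟩, Subtype.ext hwz⟩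
  refine IsAlgebraic.of_pow hn ?_
  rw [hwz]
  exact mem_algebraicClosure_iff.mp z.2

instance : Fact (ringChar Fq).Prime := ⟨CharP.char_is_prime Fq _⟩

variable {Fq} in
lemma add_pow_q {L : Type*} [Field L] [Algebra (K Fq) L] (x y : L) :
    (x + y) ^ q Fq = x ^ q Fq + y ^ q Fq := by
  obtain ⟨n, _, hn⟩ := FiniteField.card Fq (ringChar Fq)
  have : CharP L (ringChar Fq) := charP_of_injective_ringHom
    ((algebraMap (K Fq) L).comp (algebraMap Fq (K Fq))).injective _
  change _ ^ Fintype.card Fq = _ ^ Fintype.card Fq + _ ^ Fintype.card Fq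
  rw [hn]
  exact add_pow_char_pow x y _ _

/-- The `q`-power Frobenius endomorphism of an extension of `K`. -/
noncomputable def qFrob (L : Type*) [Field L] [Algebra (K Fq) L] : L →+* L where
  toFun x := x ^ q Fq
  map_one' := one_pow _
  map_mul' x y := mul_pow x y _
  map_zero' := zero_pow Fintype.card_ne_zero
  map_add' := add_pow_q

@[simp] lemma qFrob_apply {L : Type*} [Field L] [Algebra (K Fq) L] (x : L) :
    qFrob Fq L x = x ^ q Fq := rfl

variable {Fq} in
-- `X^q - X` already has all its `q` roots in `𝔽_q`.
lemma exists_algebraMap_eq_of_pow_q_eq {L : Type*} [Field L] [Algebra (K Fq) L] (x : L)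
    (hx : x ^ q Fq = x) : ∃ c : Fq, algebraMap (K Fq) L (algebraMap Fq (K Fq) c) = x := by
  classical
  let f := (algebraMap (K Fq) L).comp (algebraMap Fq (K Fq))
  have h0 : (Polynomial.X ^ q Fq - Polynomial.X : Polynomial Fq) ≠ 0 :=
    FiniteField.X_pow_card_sub_X_ne_zero Fq (one_lt_q Fq)
  have hs : (Polynomial.X ^ q Fq - Polynomial.X : Polynomial Fq).Splits := by
    rw [Polynomial.splits_iff_card_roots, FiniteField.roots_X_pow_card_sub_X,
      FiniteField.X_pow_card_sub_X_natDegree_eq Fq (one_lt_q Fq)]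
    rfl
  exact hs.mem_range_of_isRoot h0 (i := f) (x := x) (by simp [hx])

end FieldFacts

/-! ### Gauss norms and evaluation of power series on a disc. -/

section GaussNorm

open Filter Topology

variable {L : Type*} [NormedField L]

/-- The power series `f` has Gauss norm at most `M` on the closed disc of radius `r`. -/
def GaussBound (r M : ℝ) (f : PowerSeries L) : Prop :=
  ∀ n, ‖PowerSeries.coeff n f‖ * r ^ n ≤ M

variable {r M N : ℝ} {f g : PowerSeries L}

lemma GaussBound.nonneg (hf : GaussBound r M f) : 0 ≤ M :=
  le_trans (by simp) (hf 0)

lemma GaussBound.mono (hf : GaussBound r M f) (h : M ≤ N) : GaussBound r N f :=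
  fun n => (hf n).trans h

lemma GaussBound.neg (hf : GaussBound r M f) : GaussBound r M (-f) :=
  fun n => by simpa using hf n

lemma gaussBound_C (c : L) : GaussBound r ‖c‖ (PowerSeries.C c) := by
  intro n
  rw [PowerSeries.coeff_C]
  split_ifs with h
  · simp [h]
  · simp

lemma gaussBound_one : GaussBound r 1 (1 : PowerSeries L) := by
  simpa using gaussBound_C (r := r) (1 : L)

lemma gaussBound_C_mul_X (c : L) (hr : 0 ≤ r) :
    GaussBound r (‖c‖ * r) (PowerSeries.C c * PowerSeries.X) := by
  intro n
  rw [PowerSeries.coeff_C_mul, PowerSeries.coeff_X]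
  split_ifs with h
  · simp [h]
  · simpa using by positivity

lemma gaussBound_of_tendsto {ι : Type*} {l : Filter ι} [l.NeBot] {F : ι → PowerSeries L}
    (hF : ∀ i, GaussBound r M (F i))
    (hlim : ∀ n, Tendsto (fun i => PowerSeries.coeff n (F i)) l (𝓝 (PowerSeries.coeff n f))) :
    GaussBound r M f := fun n =>
  le_of_tendsto ((hlim n).norm.mul_const _) (Eventually.of_forall fun i => hF i n)

section Ultrametric

variable [IsUltrametricDist L]

lemma GaussBound.add (hr : 0 ≤ r) (hf : GaussBound r M f) (hg : GaussBound r N g) :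
    GaussBound r (max M N) (f + g) := by
  intro n
  have h1 := IsUltrametricDist.norm_add_le_max (PowerSeries.coeff n f) (PowerSeries.coeff n g)
  have h2 := mul_le_mul_of_nonneg_right h1 (pow_nonneg hr n)
  rw [max_mul_of_nonneg _ _ (pow_nonneg hr n)] at h2
  rw [map_add]
  exact h2.trans (max_le_max (hf n) (hg n))

lemma GaussBound.mul (hr : 0 ≤ r) (hf : GaussBound r M f) (hg : GaussBound r N g) :
    GaussBound r (M * N) (f * g) := by
  intro n
  rcases hr.eq_or_lt with rfl | hr
  · rcases n with _ | n
    · have h1 := hf 0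
      have h2 := hg 0
      simp only [pow_zero, mul_one, PowerSeries.coeff_zero_eq_constantCoeff, map_mul,
        norm_mul] at *
      exact mul_le_mul h1 h2 (norm_nonneg _) hf.nonneg
    · simpa using mul_nonneg hf.nonneg hg.nonneg
  have hrn := pow_pos hr n
  rw [← le_div_iff₀ hrn, PowerSeries.coeff_mul]
  refine IsUltrametricDist.norm_sum_le_of_forall_le_of_nonneg
    (div_nonneg (mul_nonneg hf.nonneg hg.nonneg) hrn.le) fun x hx => ?_
  rw [le_div_iff₀ hrn, norm_mul, ← Finset.HasAntidiagonal.mem_antidiagonal.mp hx, pow_add]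
  calc _ = (‖PowerSeries.coeff x.1 f‖ * r ^ x.1) * (‖PowerSeries.coeff x.2 g‖ * r ^ x.2) := by ring
    _ ≤ M * N := mul_le_mul (hf _) (hg _) (by positivity) hf.nonneg

lemma gaussBound_prod {ι : Type*} (hr : 0 ≤ r) (s : Finset ι) (F : ι → PowerSeries L) (c : ι → ℝ)
    (h : ∀ i ∈ s, GaussBound r (c i) (F i)) : GaussBound r (∏ i ∈ s, c i) (∏ i ∈ s, F i) := by
  classical
  induction s using Finset.induction_on with
  | empty => simpa using gaussBound_one
  | insert a s ha ih =>
    rw [Finset.prod_insert ha, Finset.prod_insert ha]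
    exact (h a (Finset.mem_insert_self _ _)).mul hr
      (ih fun i hi => h i (Finset.mem_insert_of_mem hi))

lemma gaussBound_one_sub (c : L) (hr : 0 ≤ r) (hc : ‖c‖ * r ≤ 1) :
    GaussBound r 1 (1 - PowerSeries.C c * PowerSeries.X) := by
  rw [sub_eq_add_neg]
  exact (gaussBound_one.add hr (gaussBound_C_mul_X c hr).neg).mono (max_le le_rfl hc)

/-- By the recursion for the coefficients of an inverse: with constant term `1` nothing is divided,
and the ultrametric inequality preserves the bound `1`. -/
lemma GaussBound.inv (hr : 0 < r) (hf : GaussBound r 1 f)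
    (h1 : PowerSeries.constantCoeff f = 1) : GaussBound r 1 f⁻¹ := by
  intro n
  induction n using Nat.strong_induction_on with
  | _ n ih =>
    have hrn := pow_pos hr n
    rw [PowerSeries.coeff_inv]
    split_ifs with h
    · simp [h, h1]
    · rw [h1, inv_one, norm_mul, norm_neg, norm_one, one_mul, ← le_div_iff₀ hrn]
      refine IsUltrametricDist.norm_sum_le_of_forall_le_of_nonneg (by positivity) fun x hx => ?_
      split_ifs with h2
      · rw [le_div_iff₀ hrn, norm_mul, ← Finset.HasAntidiagonal.mem_antidiagonal.mp hx, pow_add]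
        calc _ = (‖PowerSeries.coeff x.1 f‖ * r ^ x.1) * (‖PowerSeries.coeff x.2 f⁻¹‖ * r ^ x.2) := by
              ring
          _ ≤ 1 * 1 := mul_le_mul (hf _) (ih _ h2) (by positivity) zero_le_one
          _ = 1 := one_mul _
      · simpa using by positivity

/-- The ring of power series which are bounded on the disc of radius `r`. -/
def boundedSeries (L : Type*) [NormedField L] [IsUltrametricDist L] (r : ℝ) (hr : 0 < r) :
    Subring (PowerSeries L) where
  carrier := {f | ∃ M, GaussBound r M f}
  mul_mem' := fun ⟨_, h1⟩ ⟨_, h2⟩ => ⟨_, h1.mul hr.le h2⟩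
  one_mem' := ⟨1, gaussBound_one⟩
  add_mem' := fun ⟨_, h1⟩ ⟨_, h2⟩ => ⟨_, h1.add hr.le h2⟩
  zero_mem' := ⟨‖(0 : L)‖, by simpa using gaussBound_C (r := r) (0 : L)⟩
  neg_mem' := fun ⟨_, h1⟩ => ⟨_, h1.neg⟩

lemma coe_polynomial_mem_boundedSeries (hr : 0 < r) (P : Polynomial L) :
    (P : PowerSeries L) ∈ boundedSeries L r hr := by
  induction P using Polynomial.induction_on' with
  | add p q hp hq => rw [Polynomial.coe_add]; exact add_mem hp hq
  | monomial n c =>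
    rw [← Polynomial.C_mul_X_pow_eq_monomial, Polynomial.coe_mul, Polynomial.coe_C,
      Polynomial.coe_pow, Polynomial.coe_X]
    have hX : (PowerSeries.X : PowerSeries L) ∈ boundedSeries L r hr :=
      ⟨_, by simpa using gaussBound_C_mul_X (1 : L) hr.le⟩
    exact mul_mem (show _ ∈ boundedSeries L r hr from ⟨_, gaussBound_C c⟩) (pow_mem hX _)

end Ultrametric

section Evaluation

/-- The value of a power series at a point. -/
noncomputable def evalSeries (z : L) (f : PowerSeries L) : L :=
  ∑' n, PowerSeries.coeff n f * z ^ n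

variable {z : L}

lemma GaussBound.norm_coeff_mul_pow_le (hr : 0 < r) (hf : GaussBound r M f) (n : ℕ) :
    ‖PowerSeries.coeff n f * z ^ n‖ ≤ M * (‖z‖ / r) ^ n := by
  have hrn := pow_pos hr n
  rw [norm_mul, norm_pow, div_pow, ← mul_div_assoc, le_div_iff₀ hrn]
  calc _ = (‖PowerSeries.coeff n f‖ * r ^ n) * ‖z‖ ^ n := by ring
    _ ≤ _ := mul_le_mul_of_nonneg_right (hf n) (by positivity)

lemma summable_geometric_bound (hr : 0 < r) (hz : ‖z‖ < r) (M : ℝ) :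
    Summable fun n : ℕ => M * (‖z‖ / r) ^ n :=
  (summable_geometric_of_lt_one (by positivity) ((div_lt_one hr).mpr hz)).mul_left M

lemma GaussBound.summable_norm (hr : 0 < r) (hz : ‖z‖ < r) (hf : GaussBound r M f) :
    Summable fun n => ‖PowerSeries.coeff n f * z ^ n‖ :=
  Summable.of_nonneg_of_le (fun _ => norm_nonneg _) (hf.norm_coeff_mul_pow_le hr)
    (summable_geometric_bound hr hz M)

lemma evalSeries_coe (P : Polynomial L) : evalSeries z (P : PowerSeries L) = P.eval z := by
  rw [evalSeries, Polynomial.eval_eq_sum, Polynomial.sum_def]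
  simp only [Polynomial.coeff_coe]
  exact tsum_eq_sum fun n hn => by simp [Polynomial.notMem_support_iff.mp hn]

variable [CompleteSpace L]

lemma evalSeries_mul (hr : 0 < r) (hz : ‖z‖ < r) (hf : GaussBound r M f) (hg : GaussBound r N g) :
    evalSeries z (f * g) = evalSeries z f * evalSeries z g := by
  have h1 : Summable fun n => ‖PowerSeries.coeff n f * z ^ n‖ := hf.summable_norm hr hz
  have h2 : Summable fun n => ‖PowerSeries.coeff n g * z ^ n‖ := hg.summable_norm hr hz
  refine Eq.trans ?_ (tsum_mul_tsum_eq_tsum_sum_antidiagonal_of_summable_norm h1 h2).symm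
  refine tsum_congr fun n => ?_
  rw [PowerSeries.coeff_mul, Finset.sum_mul]
  refine Finset.sum_congr rfl fun x hx => ?_
  rw [← Finset.HasAntidiagonal.mem_antidiagonal.mp hx, pow_add]
  ring

lemma evalSeries_add (hr : 0 < r) (hz : ‖z‖ < r) (hf : GaussBound r M f) (hg : GaussBound r N g) :
    evalSeries z (f + g) = evalSeries z f + evalSeries z g := by
  rw [evalSeries, evalSeries, evalSeries, ← (hf.summable_norm hr hz).of_norm.tsum_add
    (hg.summable_norm hr hz).of_norm]
  exact tsum_congr fun n => by rw [map_add, add_mul]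

lemma tendsto_evalSeries {ι : Type*} {l : Filter ι} (hr : 0 < r) (hz : ‖z‖ < r)
    {F : ι → PowerSeries L} (hF : ∀ i, GaussBound r M (F i))
    (hlim : ∀ n, Tendsto (fun i => PowerSeries.coeff n (F i)) l (𝓝 (PowerSeries.coeff n f))) :
    Tendsto (fun i => evalSeries z (F i)) l (𝓝 (evalSeries z f)) :=
  tendsto_tsum_of_dominated_convergence (summable_geometric_bound hr hz M)
    (fun n => (hlim n).mul_const _)
    (Eventually.of_forall fun i n => (hF i).norm_coeff_mul_pow_le hr n)

variable [IsUltrametricDist L]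

/-- Evaluation at a point of the open disc of radius `r`, as a ring homomorphism. -/
noncomputable def evalSeriesHom (r : ℝ) (hr : 0 < r) (z : L) (hz : ‖z‖ < r) :
    boundedSeries L r hr →+* L where
  toFun f := evalSeries z f
  map_one' := by simpa using evalSeries_coe (z := z) 1
  map_zero' := by simpa using evalSeries_coe (z := z) 0
  map_mul' := fun ⟨_, _, hf⟩ ⟨_, _, hg⟩ => evalSeries_mul hr hz hf hg
  map_add' := fun ⟨_, _, hf⟩ ⟨_, _, hg⟩ => evalSeries_add hr hz hf hg

end Evaluation

end GaussNorm

/-! ### The series `L_β`: convergence, difference equation, value at `θ`. -/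

section CarlitzSeries

open Filter Topology
open scoped PowerSeries.WithPiTopology

section General

variable {L : Type*} [NormedField L]

lemma GaussBound.norm_evalSeries_le {r M : ℝ} {f : PowerSeries L} {z : L} (hr : 0 < r)
    (hz : ‖z‖ < r) (hf : GaussBound r M f) :
    ‖evalSeries z f‖ ≤ M * (1 - ‖z‖ / r)⁻¹ :=
  tsum_of_norm_bounded ((hasSum_geometric_of_lt_one (by positivity)
    ((div_lt_one hr).mpr hz)).mul_left M) (hf.norm_coeff_mul_pow_le hr)

lemma gaussBound_sum [IsUltrametricDist L] {ι : Type*} {r M : ℝ} (hr : 0 ≤ r) (hM : 0 ≤ M)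
    (s : Finset ι) (F : ι → PowerSeries L) (h : ∀ i ∈ s, GaussBound r M (F i)) :
    GaussBound r M (∑ i ∈ s, F i) := by
  classical
  induction s using Finset.induction_on with
  | empty => intro n; simpa using hM
  | insert a s ha ih =>
    rw [Finset.sum_insert ha]
    exact ((h a (Finset.mem_insert_self _ _)).add hr
      (ih fun i hi => h i (Finset.mem_insert_of_mem hi))).mono (max_self M).le

lemma tendsto_map_powerSeries {ι : Type*} {l : Filter ι} {F : ι → PowerSeries L}
    {f : PowerSeries L} (φ : L →+* L) (hφ : Continuous φ) (h : Tendsto F l (𝓝 f)) :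
    Tendsto (fun i => PowerSeries.map φ (F i)) l (𝓝 (PowerSeries.map φ f)) := by
  rw [PowerSeries.WithPiTopology.tendsto_iff_coeff_tendsto] at h ⊢
  intro n
  simp only [PowerSeries.coeff_map]
  exact (hφ.tendsto _).comp (h n)

/-- Infinite products `∏ (1 - c i X)` with summable `c`. -/
lemma multipliable_one_sub_C_mul_X [CompleteSpace L] (c : ℕ → L) (hc : Summable fun i => ‖c i‖) :
    Multipliable fun i => (1 - PowerSeries.C (c i) * PowerSeries.X : PowerSeries L) := by
  have h : (fun i => (1 - PowerSeries.C (c i) * PowerSeries.X : PowerSeries L)) =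
      fun i => 1 + PowerSeries.C (-c i) * PowerSeries.X := by
    funext i; rw [map_neg]; ring
  rw [h]
  -- Expanding the product gives a sum over finite sets of indices, dominated by the expansion of `∏
  -- (1 + ‖c i‖)`.
  apply multipliable_one_add_of_summable_prod
  rw [PowerSeries.WithPiTopology.summable_iff_summable_coeff]
  intro n
  have hs : Summable fun s : Finset ℕ => ∏ i ∈ s, ‖-c i‖ := by
    have := summable_finsetProd_of_summable_norm (f := fun i => ‖c i‖) (by simpa using hc)
    simpa using this
  refine Summable.of_norm_bounded hs fun s => ?_
  rw [Finset.prod_mul_distrib, Finset.prod_const, ← map_prod, PowerSeries.coeff_C_mul_X_pow]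
  split_ifs
  · rw [norm_prod]
  · rw [norm_zero]; positivity

end General

variable (Fq : Type*) [Field Fq] [Fintype Fq]

lemma norm_theta : ‖theta Fq‖ = q Fq := by
  rw [theta, norm_algebraMap_Cinfty, absInfty_X]

lemma theta_ne_zero : theta Fq ≠ 0 := by
  rw [← norm_ne_zero_iff, norm_theta]
  have := one_lt_q Fq
  positivity

lemma continuous_qFrob : Continuous (qFrob Fq (Cinfty Fq)) := continuous_pow _

/-- The radius `q ^ q` of the disc on which all series considered are bounded. -/
noncomputable def radius : ℝ := (q Fq : ℝ) ^ q Fq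

lemma one_lt_q_real : (1 : ℝ) < q Fq := by exact_mod_cast one_lt_q Fq

lemma radius_pos : 0 < radius Fq := by
  have := one_lt_q_real Fq
  unfold radius; positivity

/-- The radius is `|θ^q|`, the absolute value of the first zero of `Ω`; evaluation takes place at
`θ`, strictly inside. -/
lemma norm_theta_lt_radius : ‖theta Fq‖ < radius Fq := by
  rw [norm_theta, radius]
  exact lt_self_pow₀ (one_lt_q_real Fq) (one_lt_q Fq)

lemma norm_theta_pow (i : ℕ) : ‖theta Fq ^ q Fq ^ (i + 1)‖ = (q Fq : ℝ) ^ q Fq ^ (i + 1) := by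
  rw [norm_pow, norm_theta]

lemma norm_theta_pow_inv_mul_radius_le (i : ℕ) :
    ‖(theta Fq ^ q Fq ^ (i + 1))⁻¹‖ * radius Fq ≤ 1 := by
  have h := one_lt_q_real Fq
  rw [norm_inv, norm_theta_pow, radius, inv_mul_le_iff₀ (by positivity), mul_one]
  exact pow_le_pow_right₀ h.le (Nat.le_self_pow (by omega) _)

lemma summable_norm_theta_pow_inv :
    Summable fun i : ℕ => ‖(theta Fq ^ q Fq ^ (i + 1))⁻¹‖ := by
  have h := one_lt_q_real Fq
  refine Summable.of_nonneg_of_le (fun _ => norm_nonneg _) (fun i => ?_)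
    (summable_geometric_of_lt_one (r := (q Fq : ℝ)⁻¹) (by positivity) (inv_lt_one_of_one_lt₀ h))
  rw [norm_inv, norm_theta_pow, inv_pow]
  refine inv_anti₀ (by positivity) (pow_le_pow_right₀ h.le ?_)
  exact (Nat.lt_pow_self (one_lt_q Fq)).le.trans (Nat.pow_le_pow_right (by have := one_lt_q Fq; omega) (Nat.le_succ i))

/-- The factor `θ^(q^(j+1)) - t`. -/
noncomputable abbrev den (j : ℕ) : PowerSeries (Cinfty Fq) :=
  PowerSeries.C (theta Fq ^ q Fq ^ (j + 1)) - PowerSeries.X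

lemma den_eq (j : ℕ) : den Fq j = PowerSeries.C (theta Fq ^ q Fq ^ (j + 1)) *
    (1 - PowerSeries.C (theta Fq ^ q Fq ^ (j + 1))⁻¹ * PowerSeries.X) := by
  rw [mul_sub, ← mul_assoc, ← map_mul, mul_inv_cancel₀ (pow_ne_zero _ (theta_ne_zero Fq)), map_one,
    one_mul, mul_one]

lemma constantCoeff_prod_den_ne_zero (i : ℕ) :
    PowerSeries.constantCoeff (∏ j ∈ Finset.range i, den Fq j) ≠ 0 := by
  rw [map_prod, Finset.prod_ne_zero_iff]
  intro j _
  simpa using theta_ne_zero Fq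

lemma map_qFrob_den (j : ℕ) : PowerSeries.map (qFrob Fq (Cinfty Fq)) (den Fq j) = den Fq (j + 1) := by
  rw [den, map_sub, PowerSeries.map_C, PowerSeries.map_X, qFrob_apply, ← pow_mul, ← pow_succ]

lemma gaussBound_prod_den_inv (i : ℕ) : GaussBound (radius Fq)
    (∏ j ∈ Finset.range i, ((q Fq : ℝ) ^ q Fq ^ (j + 1))⁻¹) (∏ j ∈ Finset.range i, den Fq j)⁻¹ := by
  induction i with
  | zero => simpa using gaussBound_one
  | succ i ih =>
    rw [Finset.prod_range_succ, Finset.prod_range_succ, PowerSeries.mul_inv_rev,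
      mul_comm (den Fq i)⁻¹]
    refine GaussBound.mul (radius_pos Fq).le ih ?_
    rw [den_eq, PowerSeries.mul_inv_rev, PowerSeries.C_inv]
    have h1 := ((gaussBound_one_sub _ (radius_pos Fq).le
      (norm_theta_pow_inv_mul_radius_le Fq i)).inv (radius_pos Fq) (by simp)).mul
      (radius_pos Fq).le (gaussBound_C (theta Fq ^ q Fq ^ (i + 1))⁻¹)
    rwa [one_mul, norm_inv, norm_theta_pow] at h1

section Logarithm

variable {Fq} (β : Cinfty Fq)

/-- The `i`-th term of the deformation of the Carlitz logarithm. -/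
noncomputable abbrev LserTerm (i : ℕ) : PowerSeries (Cinfty Fq) :=
  PowerSeries.C ((-1) ^ i * β ^ q Fq ^ i) * (∏ j ∈ Finset.range i, den Fq j)⁻¹

lemma LserTerm_mul_prod_den (i : ℕ) : LserTerm β i * ∏ j ∈ Finset.range i, den Fq j =
    PowerSeries.C ((-1) ^ i * β ^ q Fq ^ i) := by
  rw [LserTerm, mul_assoc, PowerSeries.inv_mul_cancel _ (constantCoeff_prod_den_ne_zero Fq i),
    mul_one]

variable (Fq) in
/-- The radius of convergence of the Carlitz logarithm. -/
noncomputable def logRadius : ℝ := (q Fq : ℝ) ^ ((q Fq : ℝ) / ((q Fq : ℝ) - 1))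

variable (Fq) in
lemma logRadius_pos : 0 < logRadius Fq := by
  have := one_lt_q_real Fq
  unfold logRadius; positivity

variable (Fq) in
-- Write `ρ` for the left-hand base. By induction from `ρ^(q-1) = q^q`. It turns the bound of the
-- `i`-th term of `L_β` into `ρ (|β|/ρ)^(q^i)`, which explains the condition `|β| < ρ`.
lemma logRadius_pow (i : ℕ) : logRadius Fq ^ q Fq ^ i =
    logRadius Fq * ∏ j ∈ Finset.range i, (q Fq : ℝ) ^ q Fq ^ (j + 1) := by
  have h := one_lt_q_real Fq
  have h1 : logRadius Fq ^ (q Fq - 1) = (q Fq : ℝ) ^ q Fq := by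
    rw [logRadius, ← Real.rpow_natCast, ← Real.rpow_mul (by positivity), Nat.cast_sub
      (one_lt_q Fq).le, Nat.cast_one, div_mul_cancel₀ _ (by linarith), Real.rpow_natCast]
  induction i with
  | zero => simp
  | succ i ih =>
    have h2 : q Fq ^ (i + 1) = q Fq ^ i + (q Fq - 1) * q Fq ^ i := by
      obtain ⟨n, hn⟩ : ∃ n, q Fq = n + 1 := ⟨q Fq - 1, by have := one_lt_q Fq; omega⟩
      rw [hn, Nat.add_sub_cancel]; ring
    rw [Finset.prod_range_succ, ← mul_assoc, ← ih, h2, pow_add, pow_mul _ (q Fq - 1), h1, ← pow_mul,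
      ← h2, pow_succ']

lemma gaussBound_LserTerm (i : ℕ) : GaussBound (radius Fq)
    (logRadius Fq * (‖β‖ / logRadius Fq) ^ q Fq ^ i) (LserTerm β i) := by
  have h1 := (gaussBound_C ((-1) ^ i * β ^ q Fq ^ i)).mul (radius_pos Fq).le
    (gaussBound_prod_den_inv Fq i)
  refine h1.mono (le_of_eq ?_)
  have h := one_lt_q_real Fq
  have h2 : (∏ j ∈ Finset.range i, (q Fq : ℝ) ^ q Fq ^ (j + 1)) ≠ 0 :=
    Finset.prod_ne_zero_iff.mpr fun j _ => by positivity
  have h3 := (logRadius_pos Fq).ne'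
  rw [norm_mul, norm_pow, norm_neg, norm_one, one_pow, one_mul, norm_pow, Finset.prod_inv_distrib,
    div_pow, logRadius_pow]
  field_simp

variable {β} (hβ : ‖β‖ < logRadius Fq)
include hβ

lemma summable_LserTerm_bound :
    Summable fun i : ℕ => logRadius Fq * (‖β‖ / logRadius Fq) ^ q Fq ^ i := by
  have h0 := logRadius_pos Fq
  refine Summable.mul_left _ (Summable.of_nonneg_of_le (fun _ => by positivity) (fun i => ?_)
    (summable_geometric_of_lt_one (r := ‖β‖ / logRadius Fq) (by positivity)
      ((div_lt_one h0).mpr hβ)))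
  exact pow_le_pow_of_le_one (by positivity) ((div_lt_one h0).mpr hβ).le
    (Nat.lt_pow_self (one_lt_q Fq)).le

lemma hasSum_LserTerm : HasSum (LserTerm β) (Lser β) := by
  refine Summable.hasSum ?_
  rw [PowerSeries.WithPiTopology.summable_iff_summable_coeff]
  intro n
  have hrn := pow_pos (radius_pos Fq) n
  refine Summable.of_norm_bounded ((summable_LserTerm_bound hβ).div_const (radius Fq ^ n))
    fun i => ?_
  rw [le_div_iff₀ hrn]
  exact gaussBound_LserTerm β i n

lemma gaussBound_LserTerm_logRadius (i : ℕ) :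
    GaussBound (radius Fq) (logRadius Fq) (LserTerm β i) := by
  refine (gaussBound_LserTerm β i).mono ?_
  have h0 := logRadius_pos Fq
  exact mul_le_of_le_one_right h0.le
    (pow_le_one₀ (by positivity) ((div_lt_one h0).mpr hβ).le)

lemma gaussBound_sum_LserTerm (n : ℕ) :
    GaussBound (radius Fq) (logRadius Fq) (∑ i ∈ Finset.range n, LserTerm β i) :=
  gaussBound_sum (radius_pos Fq).le (logRadius_pos Fq).le _ _
    fun i _ => gaussBound_LserTerm_logRadius hβ i

lemma gaussBound_Lser : GaussBound (radius Fq) (logRadius Fq) (Lser β) :=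
  gaussBound_of_tendsto (gaussBound_sum_LserTerm hβ) fun n =>
    (PowerSeries.WithPiTopology.tendsto_iff_coeff_tendsto _ _ _ _).mp
      (hasSum_LserTerm hβ).tendsto_sum_nat n

omit hβ in
lemma theta_pow_ne_theta (j : ℕ) : theta Fq ^ q Fq ^ (j + 1) - theta Fq ≠ 0 := by
  rw [sub_ne_zero]
  intro h
  have h1 := congrArg norm h
  rw [norm_theta_pow, norm_theta] at h1
  exact (lt_self_pow₀ (one_lt_q_real Fq)
    (Nat.one_lt_pow (Nat.succ_ne_zero j) (one_lt_q Fq))).ne' h1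

omit hβ in
variable (β) in
-- Multiplying by the polynomial denominator leaves a constant, and evaluation is multiplicative on
-- bounded series.
lemma evalSeries_LserTerm (i : ℕ) : evalSeries (theta Fq) (LserTerm β i) =
    (-1) ^ i * β ^ q Fq ^ i / ∏ j ∈ Finset.range i, (theta Fq ^ q Fq ^ (j + 1) - theta Fq) := by
  have hpoly : ∏ j ∈ Finset.range i, den Fq j = ((∏ j ∈ Finset.range i,
      (Polynomial.C (theta Fq ^ q Fq ^ (j + 1)) - Polynomial.X) : Polynomial (Cinfty Fq)) :
        PowerSeries (Cinfty Fq)) := by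
    rw [← Polynomial.coeToPowerSeries.ringHom_apply, map_prod]
    simp [den]
  obtain ⟨M, hM⟩ := coe_polynomial_mem_boundedSeries (radius_pos Fq) (∏ j ∈ Finset.range i,
      (Polynomial.C (theta Fq ^ q Fq ^ (j + 1)) - Polynomial.X) : Polynomial (Cinfty Fq))
  have h1 := evalSeries_mul (radius_pos Fq) (norm_theta_lt_radius Fq)
    (gaussBound_LserTerm β i) hM
  rw [← hpoly, LserTerm_mul_prod_den, hpoly, evalSeries_coe, ← Polynomial.coe_C, evalSeries_coe,
    Polynomial.eval_C, Polynomial.eval_prod] at h1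
  rw [eq_div_iff (Finset.prod_ne_zero_iff.mpr fun j _ => theta_pow_ne_theta j), h1]
  simp

/-- The value of `L_β` at `θ` is the Carlitz logarithm of `β`. -/
lemma evalSeries_Lser : evalSeries (theta Fq) (Lser β) = logCar β := by
  have hr := radius_pos Fq
  have hz := norm_theta_lt_radius Fq
  have h1 : Tendsto (fun n => evalSeries (theta Fq) (∑ i ∈ Finset.range n, LserTerm β i)) atTop
      (𝓝 (evalSeries (theta Fq) (Lser β))) :=
    tendsto_evalSeries hr hz (gaussBound_sum_LserTerm hβ) fun n =>
      (PowerSeries.WithPiTopology.tendsto_iff_coeff_tendsto _ _ _ _).mp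
        (hasSum_LserTerm hβ).tendsto_sum_nat n
  have h2 : ∀ n, evalSeries (theta Fq) (∑ i ∈ Finset.range n, LserTerm β i) =
      ∑ i ∈ Finset.range n, evalSeries (theta Fq) (LserTerm β i) := by
    intro n
    induction n with
    | zero => simp [evalSeries]
    | succ n ih =>
      rw [Finset.sum_range_succ, Finset.sum_range_succ, ← ih]
      exact evalSeries_add hr hz (gaussBound_sum_LserTerm hβ n) (gaussBound_LserTerm β n)
  simp_rw [h2] at h1
  have h3 : Summable fun i => evalSeries (theta Fq) (LserTerm β i) :=
    Summable.of_norm_bounded ((summable_LserTerm_bound hβ).mul_right _)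
      fun i => (gaussBound_LserTerm β i).norm_evalSeries_le hr hz
  rw [tendsto_nhds_unique h1 h3.hasSum.tendsto_sum_nat, logCar]
  exact tsum_congr fun i => evalSeries_LserTerm β i

omit hβ in
variable (β) in
-- Frobenius shifts the factors of the denominator by one, so the factor `θ^q - t` of the next term
-- is missing; the change of sign absorbs `(-1)^(i+1)`.
lemma map_qFrob_LserTerm (i : ℕ) : PowerSeries.map (qFrob Fq (Cinfty Fq)) (LserTerm β i) =
    (PowerSeries.X - PowerSeries.C (theta Fq ^ q Fq)) * LserTerm β (i + 1) := by
  have hD : ∏ j ∈ Finset.range i, den Fq (j + 1) =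
      PowerSeries.map (qFrob Fq (Cinfty Fq)) (∏ j ∈ Finset.range i, den Fq j) := by
    rw [map_prod]
    exact Finset.prod_congr rfl fun j _ => (map_qFrob_den Fq j).symm
  have hD0 : ∏ j ∈ Finset.range i, den Fq (j + 1) ≠ 0 := by
    rw [Finset.prod_ne_zero_iff]
    intro j _ h
    simpa [den, theta_ne_zero] using congrArg PowerSeries.constantCoeff h
  apply mul_right_cancel₀ hD0
  have h1 : PowerSeries.map (qFrob Fq (Cinfty Fq)) (LserTerm β i) *
      ∏ j ∈ Finset.range i, den Fq (j + 1) =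
      PowerSeries.C ((-1) ^ i * β ^ q Fq ^ (i + 1)) := by
    rw [hD, ← map_mul, LserTerm_mul_prod_den, PowerSeries.map_C, map_mul, map_pow, map_neg, map_one,
      qFrob_apply, ← pow_mul, ← pow_succ]
  have h2 := LserTerm_mul_prod_den β (i + 1)
  rw [Finset.prod_range_succ'] at h2
  rw [h1]
  have h3 : (PowerSeries.X - PowerSeries.C (theta Fq ^ q Fq)) = -den Fq 0 := by
    rw [den, zero_add, pow_one, neg_sub]
  rw [h3, pow_succ (-1 : Cinfty Fq) i, mul_neg_one, neg_mul, map_neg] at *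
  linear_combination h2

/-- The difference equation of `L_β`. -/
lemma map_qFrob_Lser : PowerSeries.map (qFrob Fq (Cinfty Fq)) (Lser β) =
    (PowerSeries.X - PowerSeries.C (theta Fq ^ q Fq)) * (Lser β - PowerSeries.C β) := by
  have h1 := (hasSum_LserTerm hβ).tendsto_sum_nat
  have h2 := tendsto_map_powerSeries _ (continuous_qFrob Fq) h1
  have h3 : ∀ n, PowerSeries.map (qFrob Fq (Cinfty Fq)) (∑ i ∈ Finset.range n, LserTerm β i) =
      (PowerSeries.X - PowerSeries.C (theta Fq ^ q Fq)) *
        (∑ i ∈ Finset.range (n + 1), LserTerm β i - PowerSeries.C β) := by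
    intro n
    rw [map_sum, Finset.sum_range_succ']
    simp only [map_qFrob_LserTerm]
    -- The term of index `0` is not hit by the shift; it is the source of the inhomogeneous term
    -- `β`.
    have h0 : LserTerm β 0 = PowerSeries.C β := by simp [LserTerm]
    rw [← Finset.mul_sum, h0, add_sub_cancel_right]
  simp_rw [h3] at h2
  exact tendsto_nhds_unique h2
    ((((tendsto_add_atTop_iff_nat 1).mpr h1).sub_const _).const_mul _)

end Logarithm

end CarlitzSeries

/-! ### The series `Ω` and `L_0`: difference equations, value at `θ`. -/

section Period

open Filter Topology
open scoped PowerSeries.WithPiTopology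

variable (Fq : Type*) [Field Fq] [Fintype Fq]

/-- The coefficients `θ^(-q^(i+1))` of the factors of `Ω`. -/
noncomputable abbrev zeroInv (i : ℕ) : Cinfty Fq := (theta Fq ^ q Fq ^ (i + 1))⁻¹

/-- The factor `1 - t / θ^(q^(i+1))` of `Ω`. -/
noncomputable abbrev omegaFactor (i : ℕ) : PowerSeries (Cinfty Fq) :=
  1 - PowerSeries.C (zeroInv Fq i) * PowerSeries.X

/-- The product `∏ (1 - t / θ^(q^i))`. -/
noncomputable def omegaProd : PowerSeries (Cinfty Fq) := ∏' i, omegaFactor Fq i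

lemma tendsto_omegaProd :
    Tendsto (fun n => ∏ i ∈ Finset.range n, omegaFactor Fq i) atTop (𝓝 (omegaProd Fq)) :=
  (multipliable_one_sub_C_mul_X _ (summable_norm_theta_pow_inv Fq)).hasProd.tendsto_prod_nat

lemma gaussBound_prod_omegaFactor (n : ℕ) :
    GaussBound (radius Fq) 1 (∏ i ∈ Finset.range n, omegaFactor Fq i) := by
  have := gaussBound_prod (radius_pos Fq).le (Finset.range n) (omegaFactor Fq) (fun _ => 1)
    fun i _ => gaussBound_one_sub _ (radius_pos Fq).le (norm_theta_pow_inv_mul_radius_le Fq i)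
  simpa using this

lemma gaussBound_omegaProd : GaussBound (radius Fq) 1 (omegaProd Fq) :=
  gaussBound_of_tendsto (gaussBound_prod_omegaFactor Fq)
    ((PowerSeries.WithPiTopology.tendsto_iff_coeff_tendsto _ _ _ _).mp (tendsto_omegaProd Fq))

lemma constantCoeff_omegaProd : PowerSeries.constantCoeff (omegaProd Fq) = 1 := by
  have h1 := (PowerSeries.WithPiTopology.continuous_constantCoeff (Cinfty Fq)).tendsto _ |>.comp
    (tendsto_omegaProd Fq)
  refine tendsto_nhds_unique h1 ?_
  have h2 : ∀ n, PowerSeries.constantCoeff (∏ i ∈ Finset.range n, omegaFactor Fq i) = 1 := by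
    intro n
    rw [map_prod]
    exact Finset.prod_eq_one fun i _ => by simp
  simp only [Function.comp_def, h2]
  exact tendsto_const_nhds

lemma omegaProd_eq_mul_map : omegaProd Fq =
    PowerSeries.map (qFrob Fq (Cinfty Fq)) (omegaProd Fq) * omegaFactor Fq 0 := by
  have h1 := tendsto_map_powerSeries _ (continuous_qFrob Fq) (tendsto_omegaProd Fq)
  have h2 := h1.mul_const (omegaFactor Fq 0)
  have h3 : ∀ i, PowerSeries.map (qFrob Fq (Cinfty Fq)) (omegaFactor Fq i) =
      omegaFactor Fq (i + 1) := by
    intro i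
    rw [omegaFactor, map_sub, map_mul, map_one, PowerSeries.map_C, PowerSeries.map_X, qFrob_apply,
      inv_pow, ← pow_mul, ← pow_succ]
  simp only [map_prod, h3, ← Finset.prod_range_succ'] at h2
  exact tendsto_nhds_unique ((tendsto_add_atTop_iff_nat 1).mpr (tendsto_omegaProd Fq)) h2

variable {Fq}

lemma Omega_eq (ζ : Cinfty Fq) : Omega ζ = PowerSeries.C (ζ ^ q Fq)⁻¹ * omegaProd Fq := rfl

lemma Lzero_eq (ζ : Cinfty Fq) : Lzero ζ = -(PowerSeries.C (ζ ^ q Fq) * (omegaProd Fq)⁻¹) := by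
  rw [Lzero, Omega_eq ζ, PowerSeries.mul_inv_rev, PowerSeries.C_inv, inv_inv, mul_comm]

lemma gaussBound_Omega (ζ : Cinfty Fq) : ∃ M, GaussBound (radius Fq) M (Omega ζ) := by
  rw [Omega_eq ζ]
  exact ⟨_, (gaussBound_C _).mul (radius_pos Fq).le (gaussBound_omegaProd Fq)⟩

lemma gaussBound_Lzero (ζ : Cinfty Fq) : ∃ M, GaussBound (radius Fq) M (Lzero ζ) := by
  rw [Lzero_eq ζ]
  exact ⟨_, ((gaussBound_C _).mul (radius_pos Fq).le ((gaussBound_omegaProd Fq).inv (radius_pos Fq)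
    (constantCoeff_omegaProd Fq))).neg⟩

variable {ζ : Cinfty Fq} (hζ : ζ ^ (q Fq - 1) = -theta Fq)
include hζ

lemma zeta_ne_zero : ζ ≠ 0 := by
  rintro rfl
  rw [zero_pow (by have := one_lt_q Fq; omega)] at hζ
  exact theta_ne_zero Fq (neg_eq_zero.mp hζ.symm)

lemma zeta_pow_q : ζ ^ q Fq = -theta Fq * ζ := by
  rw [← hζ, ← pow_succ, Nat.sub_add_cancel (one_lt_q Fq).le]

lemma Omega_mul_Lzero : Omega ζ * Lzero ζ = -1 := by
  rw [Lzero, mul_neg, PowerSeries.mul_inv_cancel]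
  rw [Omega_eq ζ, map_mul, constantCoeff_omegaProd, mul_one]
  simpa using zeta_ne_zero hζ

/-- The difference equation of `Ω`. -/
lemma Omega_eq_mul_map : Omega ζ = (PowerSeries.X - PowerSeries.C (theta Fq ^ q Fq)) *
    PowerSeries.map (qFrob Fq (Cinfty Fq)) (Omega ζ) := by
  -- The choice of `ζ` enters here: the normalising constant supplies the factor `-θ^q` that turns
  -- `1 - t/θ^q` into `t - θ^q`.
  have h1 : (ζ ^ q Fq)⁻¹ = -(theta Fq ^ q Fq) * ((ζ ^ q Fq)⁻¹) ^ q Fq := by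
    have h2 : (ζ ^ q Fq) ^ q Fq = -(theta Fq ^ q Fq) * ζ ^ q Fq := by
      have h3 := congrArg (qFrob Fq (Cinfty Fq)) (zeta_pow_q hζ)
      rw [map_mul, map_neg] at h3
      simpa using h3
    have h4 := pow_ne_zero (q Fq) (zeta_ne_zero hζ)
    have h5 := neg_ne_zero.mpr (pow_ne_zero (q Fq) (theta_ne_zero Fq))
    rw [inv_pow, h2, mul_inv, ← mul_assoc, mul_inv_cancel₀ h5, one_mul]
  have h6 : (PowerSeries.X - PowerSeries.C (theta Fq ^ q Fq)) =
      PowerSeries.C (-(theta Fq ^ q Fq)) * omegaFactor Fq 0 := by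
    have := den_eq Fq 0
    rw [den, zero_add, pow_one] at this
    rw [map_neg, neg_mul, omegaFactor, zeroInv, zero_add, pow_one, ← this, neg_sub]
  conv_lhs => rw [Omega_eq ζ, omegaProd_eq_mul_map, h1]
  rw [Omega_eq ζ, map_mul (PowerSeries.map _), PowerSeries.map_C, h6, qFrob_apply,
    map_mul PowerSeries.C]
  ring

/-- The difference equation of `L_0`. -/
lemma map_qFrob_Lzero : PowerSeries.map (qFrob Fq (Cinfty Fq)) (Lzero ζ) =
    (PowerSeries.X - PowerSeries.C (theta Fq ^ q Fq)) * Lzero ζ := by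
  have h1 := Omega_mul_Lzero hζ
  have h2 := congrArg (PowerSeries.map (qFrob Fq (Cinfty Fq))) h1
  rw [map_mul, map_neg, map_one] at h2
  have h3 := Omega_eq_mul_map hζ
  have h0 : Omega ζ ≠ 0 := by
    intro h; rw [h, zero_mul] at h1; simp at h1
  apply mul_left_cancel₀ h0
  linear_combination (PowerSeries.map (qFrob Fq (Cinfty Fq)) (Lzero ζ)) * h3 +
    (PowerSeries.X - PowerSeries.C (theta Fq ^ q Fq)) * (h2 - h1)

lemma Lzero_ne_zero : Lzero ζ ≠ 0 := by
  intro h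
  have h1 := Omega_mul_Lzero hζ
  rw [h, mul_zero] at h1
  simp at h1

/-- The value of `L_0` at `θ` is the Carlitz period. -/
lemma evalSeries_Lzero : evalSeries (theta Fq) (Lzero ζ) = piTilde ζ := by
  have hr := radius_pos Fq
  have hz := norm_theta_lt_radius Fq
  have hθ := theta_ne_zero Fq
  set w : ℕ → Cinfty Fq := fun i => zeroInv Fq i * theta Fq with hw
  have hzpow : ∀ i : ℕ, theta Fq ^ (1 - (q Fq : ℤ) ^ (i + 1)) = w i := by
    intro i
    rw [zpow_sub₀ hθ, zpow_one, hw]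
    simp only [zeroInv]
    rw [div_eq_mul_inv, mul_comm]
    congr 2
  have hwn : ∀ i, ‖w i‖ < 1 := by
    intro i
    rw [hw, norm_mul]
    have h1 := norm_theta_pow_inv_mul_radius_le Fq i
    have h2 : 0 < ‖zeroInv Fq i‖ := norm_pos_iff.mpr (inv_ne_zero (pow_ne_zero _ hθ))
    exact (mul_lt_mul_of_pos_left hz h2).trans_le h1
  have hw1 : ∀ i, ‖1 - w i‖ = 1 := by
    intro i
    have h := IsUltrametricDist.norm_add_eq_max_of_norm_ne_norm (x := (1 : Cinfty Fq)) (y := -w i)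
      (by rw [norm_one, norm_neg]; exact (hwn i).ne')
    rw [← sub_eq_add_neg, norm_one, norm_neg, max_eq_left (hwn i).le] at h
    exact h
  have hw0 : ∀ i, 1 - w i ≠ 0 := fun i => by rw [← norm_ne_zero_iff, hw1]; exact one_ne_zero
  have hmul : Multipliable fun i => (1 - w i)⁻¹ := by
    have h : (fun i => (1 - w i)⁻¹) = fun i => 1 + w i / (1 - w i) := by
      funext i
      rw [eq_comm, ← mul_eq_mul_right_iff.trans (or_iff_left (hw0 i)), add_mul,
        div_mul_cancel₀ _ (hw0 i), inv_mul_cancel₀ (hw0 i)]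
      ring
    rw [h]
    refine multipliable_one_add_of_summable ?_
    simp only [norm_div, hw1, div_one]
    simp only [hw, norm_mul]
    exact (summable_norm_theta_pow_inv Fq).mul_right _
  have hT1 := hmul.hasProd.tendsto_prod_nat
  have hfac : ∀ n, evalSeries (theta Fq) (∏ i ∈ Finset.range n, omegaFactor Fq i) =
      ∏ i ∈ Finset.range n, (1 - w i) := by
    intro n
    have hpoly : ∏ i ∈ Finset.range n, omegaFactor Fq i = ((∏ i ∈ Finset.range n,
        (1 - Polynomial.C (zeroInv Fq i) * Polynomial.X) : Polynomial (Cinfty Fq)) :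
          PowerSeries (Cinfty Fq)) := by
      rw [← Polynomial.coeToPowerSeries.ringHom_apply, map_prod]
      simp [omegaFactor]
    rw [hpoly, evalSeries_coe, Polynomial.eval_prod]
    simp [hw]
  have hT2 : Tendsto (fun n => evalSeries (theta Fq) (∏ i ∈ Finset.range n, omegaFactor Fq i)) atTop
      (𝓝 (evalSeries (theta Fq) (omegaProd Fq))) :=
    tendsto_evalSeries hr hz (gaussBound_prod_omegaFactor Fq)
      ((PowerSeries.WithPiTopology.tendsto_iff_coeff_tendsto _ _ _ _).mp (tendsto_omegaProd Fq))
  simp_rw [hfac] at hT2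
  have h1 : evalSeries (theta Fq) (omegaProd Fq) * ∏' i, (1 - w i)⁻¹ = 1 := by
    refine tendsto_nhds_unique (hT2.mul hT1) ?_
    have : ∀ n, (∏ i ∈ Finset.range n, (1 - w i)) * ∏ i ∈ Finset.range n, (1 - w i)⁻¹ = 1 := by
      intro n
      rw [← Finset.prod_mul_distrib]
      exact Finset.prod_eq_one fun i _ => mul_inv_cancel₀ (hw0 i)
    simp only [this]
    exact tendsto_const_nhds
  obtain ⟨M, hM⟩ := gaussBound_Lzero ζ
  have h2 := evalSeries_mul hr hz (gaussBound_omegaProd Fq) hM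
  -- This constant equals `θ ζ`, the prefactor of the period.
  have h3 : omegaProd Fq * Lzero ζ = ((Polynomial.C (-(ζ ^ q Fq)) : Polynomial (Cinfty Fq)) :
      PowerSeries (Cinfty Fq)) := by
    rw [Lzero_eq ζ, mul_neg, mul_left_comm, PowerSeries.mul_inv_cancel _
      (by rw [constantCoeff_omegaProd]; exact one_ne_zero), mul_one, Polynomial.coe_C, map_neg]
  rw [h3, evalSeries_coe, Polynomial.eval_C, zeta_pow_q hζ] at h2
  have h4 : evalSeries (theta Fq) (omegaProd Fq) ≠ 0 := left_ne_zero_of_mul_eq_one h1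
  apply mul_left_cancel₀ h4
  simp only [piTilde, hzpow]
  linear_combination -h2 - theta Fq * ζ * h1

end Period

/-! ### Rational functions, their `p`-basis and twisted equations. -/

section RationalFunctions

variable {k L : Type*} [Field k] [Field L] [Algebra k L]

variable (k L) in
/-- Polynomials over `k`, as power series over `L`. -/
noncomputable def polyToSeries : Polynomial k →+* PowerSeries L :=
  Polynomial.coeToPowerSeries.ringHom.comp (Polynomial.mapRingHom (algebraMap k L))

lemma polyToSeries_apply (P : Polynomial k) :
    polyToSeries k L P = ((P.map (algebraMap k L) : Polynomial L) : PowerSeries L) := rfl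

@[simp] lemma polyToSeries_C (c : k) :
    polyToSeries k L (Polynomial.C c) = PowerSeries.C (algebraMap k L c) := by
  simp [polyToSeries_apply]

@[simp] lemma polyToSeries_X : polyToSeries k L Polynomial.X = PowerSeries.X := by
  simp [polyToSeries_apply]

lemma polyToSeries_injective : Function.Injective (polyToSeries k L) :=
  fun _ _ h => Polynomial.map_injective _ (algebraMap k L).injective (Polynomial.coe_injective L h)

variable (k L) in
/-- The embedding `k(t) → L((t))`. -/
noncomputable def ratToLaurent : RatFunc k →+* LaurentSeries L :=
  IsFractionRing.map (polyToSeries_injective (k := k) (L := L))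

lemma ratToLaurent_algebraMap (P : Polynomial k) :
    ratToLaurent k L (algebraMap _ _ P) = HahnSeries.ofPowerSeries ℤ L (polyToSeries k L P) := by
  rw [← LaurentSeries.coe_algebraMap]
  rw [ratToLaurent, IsFractionRing.map, IsLocalization.map_eq]

/-- The action of an endomorphism of `L` on the coefficients of Laurent series. -/
noncomputable def mapLaurent (φ : L →+* L) : LaurentSeries L →+* LaurentSeries L :=
  IsFractionRing.map (PowerSeries.map_injective φ φ.injective)

lemma mapLaurent_coe (φ : L →+* L) (f : PowerSeries L) :
    mapLaurent φ (HahnSeries.ofPowerSeries ℤ L f) =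
      HahnSeries.ofPowerSeries ℤ L (PowerSeries.map φ f) := by
  rw [← LaurentSeries.coe_algebraMap]
  rw [mapLaurent, IsFractionRing.map, IsLocalization.map_eq]

/-- The action of an endomorphism of `k` on the coefficients of rational functions. -/
noncomputable def mapRatFunc (φ : k →+* k) : RatFunc k →+* RatFunc k :=
  IsFractionRing.map (j := Polynomial.mapRingHom φ) (Polynomial.map_injective φ φ.injective)

lemma mapRatFunc_algebraMap (φ : k →+* k) (P : Polynomial k) :
    mapRatFunc φ (algebraMap _ _ P) = algebraMap _ _ (P.map φ) := by
  unfold mapRatFunc IsFractionRing.map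
  rw [IsLocalization.map_eq]
  rfl

lemma mapLaurent_ratToLaurent (φ : k →+* k) (ψ : L →+* L)
    (h : ∀ c, ψ (algebraMap k L c) = algebraMap k L (φ c)) (e : RatFunc k) :
    mapLaurent ψ (ratToLaurent k L e) = ratToLaurent k L (mapRatFunc φ e) := by
  have : (mapLaurent ψ).comp (ratToLaurent k L) = (ratToLaurent k L).comp (mapRatFunc φ) := by
    refine IsLocalization.ringHom_ext (nonZeroDivisors (Polynomial k)) ?_
    refine Polynomial.ringHom_ext (fun c => ?_) ?_
    · simp only [RingHom.comp_apply, ratToLaurent_algebraMap, mapLaurent_coe, mapRatFunc_algebraMap,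
        polyToSeries_C, PowerSeries.map_C, Polynomial.map_C, h]
    · simp only [RingHom.comp_apply, ratToLaurent_algebraMap, mapLaurent_coe, mapRatFunc_algebraMap,
        polyToSeries_X, PowerSeries.map_X, Polynomial.map_X]
  exact congrArg (fun f => f e) this

/-- Over a perfect field, every rational function is a combination of `1, t, …, t^(p-1)` with
coefficients which are `p`-th powers. -/
lemma RatFunc_eq_sum_X_pow_mul_pow (p : ℕ) [Fact p.Prime] [CharP k p]
    (hk : ∀ z : k, ∃ w, w ^ p = z) (e : RatFunc k) :
    ∃ c : ℕ → RatFunc k, e = ∑ i ∈ Finset.range p, RatFunc.X ^ i * c i ^ p := by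
  have hp : p.Prime := Fact.out
  have hpoly : ∀ P : Polynomial k, ∃ c : ℕ → Polynomial k,
      P = ∑ i ∈ Finset.range p, Polynomial.X ^ i * c i ^ p := by
    intro P
    induction P using Polynomial.induction_on' with
    | add P Q hP hQ =>
      obtain ⟨c, hc⟩ := hP
      obtain ⟨d, hd⟩ := hQ
      refine ⟨c + d, ?_⟩
      conv_lhs => rw [hc, hd]
      rw [← Finset.sum_add_distrib]
      refine Finset.sum_congr rfl fun i _ => ?_
      rw [Pi.add_apply, add_pow_char, mul_add]
    | monomial n z =>
      obtain ⟨w, rfl⟩ := hk z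
      refine ⟨fun i => if i = n % p then Polynomial.monomial (n / p) w else 0, ?_⟩
      rw [Finset.sum_eq_single (n % p)]
      · dsimp only
        rw [if_pos rfl, Polynomial.monomial_pow, Polynomial.X_pow_mul_monomial, mul_comm (n / p),
          Nat.div_add_mod]
      · intro i _ hi
        dsimp only
        rw [if_neg hi, zero_pow hp.ne_zero, mul_zero]
      · intro h
        exact absurd (Finset.mem_range.mpr (Nat.mod_lt n hp.pos)) h
  -- Rewriting `e` with denominator `denom^p` leaves only a polynomial to decompose.
  obtain ⟨c, hc⟩ := hpoly (e.num * e.denom ^ (p - 1))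
  have hD : algebraMap (Polynomial k) (RatFunc k) e.denom ≠ 0 := by
    simpa using e.denom_ne_zero
  refine ⟨fun i => algebraMap _ _ (c i) / algebraMap _ _ e.denom, ?_⟩
  have h1 := congrArg (algebraMap (Polynomial k) (RatFunc k)) hc
  have h2 : e = algebraMap _ _ (e.num * e.denom ^ (p - 1)) /
      (algebraMap (Polynomial k) (RatFunc k) e.denom) ^ p := by
    conv_lhs => rw [← RatFunc.num_div_denom e]
    rw [div_eq_div_iff hD (pow_ne_zero _ hD), map_mul, map_pow, mul_assoc, ← pow_succ,
      Nat.sub_add_cancel hp.one_le]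
  conv_lhs => rw [h2, h1, map_sum, Finset.sum_div]
  refine Finset.sum_congr rfl fun i _ => ?_
  rw [map_mul, map_pow, map_pow, RatFunc.algebraMap_X, div_pow, mul_div_assoc]

/-- The powers `1, t, …, t^(p-1)` are independent over the `p`-th powers as soon as `t` is not a
`p`-th power. -/
lemma eq_zero_of_sum_pow_mul_pow_eq_zero {F : Type*} [Field F] (p : ℕ) [Fact p.Prime] [CharP F p]
    (t : F) (ht : ∀ w : F, w ^ p ≠ t) (w : ℕ → F)
    (h : ∑ i ∈ Finset.range p, t ^ i * w i ^ p = 0) : ∀ i ∈ Finset.range p, w i = 0 := by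
  have hp : p.Prime := Fact.out
  let S : Subfield F := (frobenius F p).fieldRange
  let W : F → S := fun z => ⟨z ^ p, z, rfl⟩
  -- Frobenius is injective, so a `p`-th root of `t^p` in `F^p` would be `t` itself, which is not a
  -- `p`-th power. Hence `t` has degree `p` over `F^p`.
  have hirr : Irreducible (Polynomial.X ^ p - Polynomial.C (W t)) := by
    refine X_pow_sub_C_irreducible_of_prime hp fun b hb => ?_
    have h1 : (b : F) ^ p = t ^ p := congrArg Subtype.val hb
    obtain ⟨z, hz⟩ := b.2
    exact ht z (hz.trans (frobenius_inj F p h1))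
  have hmin : minpoly S t = Polynomial.X ^ p - Polynomial.C (W t) :=
    (minpoly.eq_of_irreducible_of_monic hirr (by
      rw [map_sub, map_pow, Polynomial.aeval_X, Polynomial.aeval_C]; exact sub_self _)
      (Polynomial.monic_X_pow_sub_C _ hp.ne_zero)).symm
  set f : Polynomial S := ∑ i ∈ Finset.range p, Polynomial.monomial i (W (w i)) with hf
  have hcoeff : ∀ i ∈ Finset.range p, f.coeff i = W (w i) := by
    intro i hi
    rw [hf, Polynomial.finsetSum_coeff, Finset.sum_eq_single i]
    · simp
    · intro b _ hb; exact Polynomial.coeff_monomial_of_ne _ (Ne.symm hb)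
    · intro h'; exact absurd hi h'
  have haeval : Polynomial.aeval t f = 0 := by
    rw [hf, map_sum, ← h]
    refine Finset.sum_congr rfl fun i _ => ?_
    rw [Polynomial.aeval_monomial, mul_comm]
    rfl
  have hf0 : f = 0 := by
    by_contra hne
    have h1 := Polynomial.natDegree_le_natDegree (minpoly.degree_le_of_ne_zero S t hne haeval)
    rw [hmin, Polynomial.natDegree_X_pow_sub_C] at h1
    have h2 : f.natDegree ≤ p - 1 := by
      refine Polynomial.natDegree_sum_le_of_forall_le _ _ fun i hi => ?_
      exact (Polynomial.natDegree_monomial_le _).trans (by have := Finset.mem_range.mp hi; omega)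
    have := hp.pos
    omega
  intro i hi
  have h1 := hcoeff i hi
  rw [hf0, Polynomial.coeff_zero] at h1
  have h2 : w i ^ p = 0 := (congrArg Subtype.val h1).symm
  exact pow_eq_zero_iff hp.ne_zero |>.mp h2

lemma pow_ne_single_one (p : ℕ) (hp : p.Prime) (w : LaurentSeries L) :
    w ^ p ≠ (HahnSeries.single 1 1 : LaurentSeries L) := by
  intro h
  have h1 := congrArg HahnSeries.order h
  rw [HahnSeries.order_pow, HahnSeries.order_single one_ne_zero, nsmul_eq_mul] at h1
  have h2 : (p : ℤ) ∣ 1 := ⟨_, h1.symm⟩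
  exact hp.one_lt.ne' (by exact_mod_cast Int.eq_one_of_dvd_one (by positivity) h2)

/-- Acting on coefficients preserves the degrees of numerator and denominator, whereas
multiplication by `a^n` raises the degree. -/
lemma eq_zero_of_mapRatFunc_eq_pow_mul (φ : k →+* k) (a : Polynomial k) (ha : 0 < a.natDegree)
    (u : RatFunc k) (n : ℕ) (hn : 0 < n) (hu : mapRatFunc φ u = algebraMap _ _ a ^ n * u) :
    u = 0 := by
  by_contra hu0
  have hN := RatFunc.num_ne_zero hu0
  have hD := u.denom_ne_zero
  have hinj := IsFractionRing.injective (Polynomial k) (RatFunc k)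
  have hD' : algebraMap (Polynomial k) (RatFunc k) u.denom ≠ 0 := by simpa using hD
  have hDφ : u.denom.map φ ≠ 0 := by simpa [Polynomial.map_eq_zero] using hD
  have hDφ' : algebraMap (Polynomial k) (RatFunc k) (u.denom.map φ) ≠ 0 := by
    simpa using hDφ
  have h1 : u.num.map φ * u.denom = a ^ n * u.num * u.denom.map φ := by
    apply hinj
    rw [← RatFunc.num_div_denom u, map_div₀, mapRatFunc_algebraMap, mapRatFunc_algebraMap,
      ← mul_div_assoc, div_eq_div_iff hDφ' hD'] at hu
    simpa using hu
  have h2 := congrArg Polynomial.natDegree h1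
  have ha0 : a ≠ 0 := by rintro rfl; simp at ha
  have hNφ : u.num.map φ ≠ 0 := by simpa [Polynomial.map_eq_zero] using hN
  rw [Polynomial.natDegree_mul hNφ hD, Polynomial.natDegree_mul
    (mul_ne_zero (pow_ne_zero _ ha0) hN) hDφ, Polynomial.natDegree_mul (pow_ne_zero _ ha0) hN,
    Polynomial.natDegree_pow, Polynomial.natDegree_map, Polynomial.natDegree_map] at h2
  have := Nat.mul_pos hn ha
  omega

/-- If `τ u = α u + c` with polynomials `α`, `c`, then the denominator of `u` is `τ`-invariant. -/
lemma map_denom_eq (φ : k →+* k) (u : RatFunc k) (α c : Polynomial k)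
    (hu : mapRatFunc φ u = algebraMap _ _ α * u + algebraMap _ _ c) :
    u.denom.map φ = u.denom := by
  have hinj := IsFractionRing.injective (Polynomial k) (RatFunc k)
  have hD := u.denom_ne_zero
  have hD' : algebraMap (Polynomial k) (RatFunc k) u.denom ≠ 0 := by simpa using hD
  have hDφ' : algebraMap (Polynomial k) (RatFunc k) (u.denom.map φ) ≠ 0 := by
    simpa [Polynomial.map_eq_zero] using hD
  have h1 : u.num.map φ * u.denom = u.denom.map φ * (α * u.num + c * u.denom) := by
    apply hinj
    have h2 := hu
    rw [← RatFunc.num_div_denom u, map_div₀, mapRatFunc_algebraMap, mapRatFunc_algebraMap] at h2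
    field_simp at h2
    simp only [map_mul, map_add]
    linear_combination h2
  have hcop : IsCoprime (u.denom.map φ) (u.num.map φ) :=
    ((RatFunc.isCoprime_num_denom u).map (Polynomial.mapRingHom φ)).symm
  -- Both denominators are monic of the same degree, so divisibility forces equality.
  have hdvd : u.denom.map φ ∣ u.denom := hcop.dvd_of_dvd_mul_left ⟨_, h1⟩
  exact (Polynomial.eq_of_monic_of_dvd_of_natDegree_le ((RatFunc.monic_denom u).map φ)
    (RatFunc.monic_denom u) hdvd (by rw [Polynomial.natDegree_map])).symm

lemma exists_polynomial_of_map_eq {R : Type*} [CommRing R] (i : R →+* k) (φ : k →+* k)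
    (hi : ∀ z, φ z = z → ∃ c, i c = z) (P : Polynomial k) (hP : P.map φ = P) :
    ∃ Q : Polynomial R, Q.map i = P := by
  have : P ∈ Polynomial.lifts i := by
    rw [Polynomial.lifts_iff_coeff_lifts]
    intro n
    refine hi _ ?_
    conv_rhs => rw [← hP]
    rw [Polynomial.coeff_map]
  exact (Polynomial.mem_lifts P).mp this

end RationalFunctions

/-! ### Invariant Laurent series are rational. -/

section FixedElements

open Filter Topology

/-- A sequence with values in a finite set which tends to zero is eventually zero. -/
lemma eventually_eq_zero_of_tendsto_of_finite {L : Type*} [NormedField L] {h : ℕ → L} {S : Set L}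
    (hS : S.Finite) (hhS : ∀ n, h n ∈ S) (hh : Tendsto h atTop (𝓝 0)) :
    ∀ᶠ n in atTop, h n = 0 := by
  have h1 : (S \ {0})ᶜ ∈ 𝓝 (0 : L) :=
    ((hS.subset Set.sdiff_subset).isClosed.isOpen_compl).mem_nhds (by simp)
  filter_upwards [hh.eventually h1] with n hn
  by_contra h0
  exact hn ⟨hhS n, h0⟩

lemma GaussBound.tendsto_coeff {L : Type*} [NormedField L] {r M : ℝ} {f : PowerSeries L}
    (hr : 1 < r) (hf : GaussBound r M f) :
    Tendsto (fun n => PowerSeries.coeff n f) atTop (𝓝 0) := by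
  refine squeeze_zero_norm (a := fun n => M * (1 / r) ^ n) (fun n => ?_) ?_
  · have hrn : 0 < r ^ n := by positivity
    rw [one_div_pow, mul_one_div, le_div_iff₀ hrn]
    exact hf n
  · have := (tendsto_pow_atTop_nhds_zero_of_lt_one (r := 1 / r) (by positivity)
      ((div_lt_one (by linarith)).mpr hr)).const_mul M
    simpa using this

variable {k L : Type*} [Field k] [NormedField L] [Algebra k L]

/-- A power series with coefficients in a finite field, which becomes bounded on a disc of radius
greater than `1` after multiplication by a nonzero polynomial, is a rational function. -/
lemma exists_ratToLaurent_eq_of_gaussBound {Fq : Type*} [Field Fq] [Finite Fq] (i : Fq →+* k)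
    (c : ℕ → Fq) {r M : ℝ} (hr : 1 < r) (D : Polynomial k) (hD : D ≠ 0)
    (h : GaussBound r M (polyToSeries k L D *
      PowerSeries.mk fun n => algebraMap k L (i (c n)))) :
    ∃ e : RatFunc k, ratToLaurent k L e =
      HahnSeries.ofPowerSeries ℤ L (PowerSeries.mk fun n => algebraMap k L (i (c n))) := by
  classical
  let : Algebra Fq k := i.toAlgebra
  set g : PowerSeries k := PowerSeries.mk fun n => i (c n) with hg
  have hgL : (PowerSeries.mk fun n => algebraMap k L (i (c n))) =
      PowerSeries.map (algebraMap k L) g := by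
    ext n; simp [hg]
  have hDL : polyToSeries k L D = PowerSeries.map (algebraMap k L) (D : PowerSeries k) := by
    ext n; simp [polyToSeries_apply]
  rw [hgL, hDL, ← map_mul] at h
  rw [hgL]
  -- All coefficients of `D g` lie in this finite space. They tend to zero because `r > 1`, so `D g`
  -- is a polynomial.
  set V : Submodule Fq k := Submodule.span Fq ((D.support.image D.coeff : Finset k) : Set k) with hV
  have hVfin : (V : Set k).Finite := by
    have : Module.Finite Fq V := Module.Finite.span_finset Fq _
    have : Finite V := Module.finite_of_finite Fq
    exact Set.toFinite _
  have hmem : ∀ n, PowerSeries.coeff n ((D : PowerSeries k) * g) ∈ V := by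
    intro n
    rw [PowerSeries.coeff_mul]
    refine Submodule.sum_mem _ fun x _ => ?_
    by_cases h0 : D.coeff x.1 = 0
    · simp [h0]
    · have : PowerSeries.coeff x.1 (D : PowerSeries k) * PowerSeries.coeff x.2 g =
          c x.2 • D.coeff x.1 := by
        rw [Algebra.smul_def, Polynomial.coeff_coe, hg, PowerSeries.coeff_mk, mul_comm]
        rfl
      rw [this]
      exact Submodule.smul_mem _ _ (Submodule.subset_span (Finset.mem_coe.mpr
        (Finset.mem_image_of_mem _ (Polynomial.mem_support_iff.mpr h0))))
  have h1 := eventually_eq_zero_of_tendsto_of_finite (hVfin.image (algebraMap k L))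
    (fun n => by rw [PowerSeries.coeff_map]; exact ⟨_, hmem n, rfl⟩) (h.tendsto_coeff hr)
  obtain ⟨N, hN⟩ := eventually_atTop.mp h1
  set Q : Polynomial k := PowerSeries.trunc N ((D : PowerSeries k) * g) with hQ
  have hQc : (Q : PowerSeries k) = (D : PowerSeries k) * g := by
    ext n
    rw [Polynomial.coeff_coe, hQ, PowerSeries.coeff_trunc]
    split_ifs with hn
    · rfl
    · have := hN n (not_lt.mp hn)
      rw [PowerSeries.coeff_map, map_eq_zero] at this
      exact this.symm
  have hQL : polyToSeries k L Q = PowerSeries.map (algebraMap k L) (Q : PowerSeries k) := by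
    ext n; simp [polyToSeries_apply]
  refine ⟨algebraMap _ _ Q / algebraMap _ _ D, ?_⟩
  have hD0 : ratToLaurent k L (algebraMap _ _ D) ≠ 0 := by
    rw [map_ne_zero]; simpa using hD
  rw [map_div₀, div_eq_iff hD0, ratToLaurent_algebraMap, ratToLaurent_algebraMap, hQL, hDL,
    ← map_mul, hQc, map_mul, mul_comm]

lemma exists_X_pow_mul_eq_coe (f : LaurentSeries L) : ∃ (N : ℕ) (g : PowerSeries L),
    HahnSeries.ofPowerSeries ℤ L (PowerSeries.X ^ N) * f = HahnSeries.ofPowerSeries ℤ L g := by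
  obtain ⟨⟨g, s, N, hs⟩, h⟩ := IsLocalization.surj (Submonoid.powers (PowerSeries.X : PowerSeries L)) f
  refine ⟨N, g, ?_⟩
  rw [← LaurentSeries.coe_algebraMap, mul_comm]
  simp only at hs h
  rw [hs]
  exact h

variable [IsUltrametricDist L]

/-- Denominators of polynomial expressions in bounded power series can be cleared. -/
lemma exists_mul_eval₂_mem_boundedSeries {σ : Type*} {r : ℝ} (hr : 0 < r) (x : σ → PowerSeries L)
    (hx : ∀ i, x i ∈ boundedSeries L r hr) (P : MvPolynomial σ (RatFunc k)) :
    ∃ D : Polynomial k, D ≠ 0 ∧ ∃ h ∈ boundedSeries L r hr, ratToLaurent k L (algebraMap _ _ D) *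
      P.eval₂ (ratToLaurent k L) (fun i => HahnSeries.ofPowerSeries ℤ L (x i)) =
        HahnSeries.ofPowerSeries ℤ L h := by
  induction P using MvPolynomial.induction_on with
  | C e =>
    refine ⟨e.denom, e.denom_ne_zero, polyToSeries k L e.num,
      coe_polynomial_mem_boundedSeries hr _, ?_⟩
    have hD : algebraMap (Polynomial k) (RatFunc k) e.denom ≠ 0 := by simpa using e.denom_ne_zero
    rw [MvPolynomial.eval₂_C, ← ratToLaurent_algebraMap, ← map_mul]
    congr 1
    conv_lhs => rw [← RatFunc.num_div_denom e]
    rw [RatFunc.num_div_denom e, mul_comm, ← eq_div_iff hD, RatFunc.num_div_denom]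
  | add P Q hP hQ =>
    obtain ⟨D, hD, f, hf, h1⟩ := hP
    obtain ⟨D', hD', f', hf', h2⟩ := hQ
    refine ⟨D * D', mul_ne_zero hD hD', polyToSeries k L D' * f + polyToSeries k L D * f',
      add_mem (mul_mem (coe_polynomial_mem_boundedSeries hr _) hf)
        (mul_mem (coe_polynomial_mem_boundedSeries hr _) hf'), ?_⟩
    rw [MvPolynomial.eval₂_add, map_add, map_mul, map_mul, map_mul, map_mul, ← h1, ← h2,
      ← ratToLaurent_algebraMap, ← ratToLaurent_algebraMap]
    ring
  | mul_X P i hP =>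
    obtain ⟨D, hD, f, hf, h1⟩ := hP
    refine ⟨D, hD, f * x i, mul_mem hf (hx i), ?_⟩
    rw [MvPolynomial.eval₂_mul, MvPolynomial.eval₂_X, map_mul, ← h1, mul_assoc]

/-- A Laurent series fixed by an endomorphism `ψ` whose fixed points lie in a finite field, and which
is a rational expression in bounded power series, is a rational function. -/
lemma exists_ratToLaurent_eq_of_mapLaurent_eq {Fq : Type*} [Field Fq] [Finite Fq] (i : Fq →+* k)
    (ψ : L →+* L) (hψ : ∀ z, ψ z = z → ∃ c, algebraMap k L (i c) = z) {σ : Type*} {r : ℝ}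
    (hr : 1 < r) (x : σ → PowerSeries L) (hx : ∀ i, x i ∈ boundedSeries L r (by linarith))
    (y w : PowerSeries L) (hw : w ∈ boundedSeries L r (by linarith)) (hyw : w * y = 1)
    (g : LaurentSeries L) (hg : mapLaurent ψ g = g) (n : ℕ) (P : MvPolynomial σ (RatFunc k))
    (hP : g * (HahnSeries.ofPowerSeries ℤ L y) ^ n =
      P.eval₂ (ratToLaurent k L) (fun i => HahnSeries.ofPowerSeries ℤ L (x i))) :
    ∃ e, ratToLaurent k L e = g := by
  have hinj : Function.Injective (HahnSeries.ofPowerSeries ℤ L) :=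
    HahnSeries.ofPowerSeries_injective
  obtain ⟨D, hD, h, hh, hDP⟩ := exists_mul_eval₂_mem_boundedSeries (by linarith : 0 < r) x hx P
  obtain ⟨N, g₀, hg₀⟩ := exists_X_pow_mul_eq_coe g
  have hg₀fix : PowerSeries.map ψ g₀ = g₀ := by
    apply hinj
    rw [← mapLaurent_coe, ← hg₀, map_mul, hg, mapLaurent_coe, map_pow, PowerSeries.map_X]
  have hcoef : ∀ m, ∃ c, algebraMap k L (i c) = PowerSeries.coeff m g₀ := fun m =>
    hψ _ (by rw [← PowerSeries.coeff_map, hg₀fix])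
  choose c hc using hcoef
  have hmk : PowerSeries.mk (fun m => algebraMap k L (i (c m))) = g₀ := by
    ext m; simp [hc]
  -- Multiplying by `w^n` removes `y^n`, so boundedness of `w` transfers the bound from the
  -- polynomial expression to `D g₀`.
  have hbd : polyToSeries k L D * g₀ = PowerSeries.X ^ N * (h * w ^ n) := by
    apply hinj
    have h1 : HahnSeries.ofPowerSeries ℤ L w * HahnSeries.ofPowerSeries ℤ L y = 1 := by
      rw [← map_mul, hyw, map_one]
    have h2 : (HahnSeries.ofPowerSeries ℤ L y) ^ n * (HahnSeries.ofPowerSeries ℤ L w) ^ n = 1 := by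
      rw [← mul_pow, mul_comm, h1, one_pow]
    rw [map_mul, map_mul, map_mul, ← hg₀, ← hDP, ← hP, ratToLaurent_algebraMap, map_pow (HahnSeries.ofPowerSeries ℤ L) w n]
    calc _ = HahnSeries.ofPowerSeries ℤ L (PowerSeries.X ^ N) *
          (HahnSeries.ofPowerSeries ℤ L (polyToSeries k L D) * g *
          1) := by ring
      _ = _ := by rw [← h2]; ring
  have hX : (PowerSeries.X : PowerSeries L) ∈ boundedSeries L r (by linarith) := by
    have := coe_polynomial_mem_boundedSeries (by linarith : 0 < r) (Polynomial.X : Polynomial L)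
    rwa [Polynomial.coe_X] at this
  obtain ⟨M, hM⟩ : PowerSeries.X ^ N * (h * w ^ n) ∈ boundedSeries L r (by linarith) :=
    mul_mem (pow_mem hX N) (mul_mem hh (pow_mem hw n))
  rw [← hbd, ← hmk] at hM
  obtain ⟨e, he⟩ := exists_ratToLaurent_eq_of_gaussBound i c hr D hD hM
  rw [hmk] at he
  have hX0 : HahnSeries.ofPowerSeries ℤ L (PowerSeries.X ^ N) ≠ 0 := by
    exact (map_ne_zero_iff _ hinj).mpr (pow_ne_zero _ PowerSeries.X_ne_zero)
  refine ⟨e / algebraMap _ _ (Polynomial.X ^ N : Polynomial k), ?_⟩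
  rw [map_div₀, he, ratToLaurent_algebraMap, map_pow, polyToSeries_X, ← hg₀,
    mul_div_cancel_left₀ _ hX0]

end FixedElements

/-! ### From algebraic dependence to a relation with polynomial coefficients. -/

section AbstractRelation

variable {k : Type*} [Field k] {Fq : Type*} [Field Fq] (const : Fq →+* k) (φ : k →+* k)
  (hconst : ∀ z, φ z = z → ∃ c, const c = z) (θ : k)

/-- The polynomial `t - φ(θ)`. -/
noncomputable abbrev twistPoly : Polynomial k := Polynomial.X - Polynomial.C (φ θ)

include hconst in
/-- A solution in `k(t)` of a difference equation with invariant coefficients gives, after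
multiplication by an invariant polynomial, a polynomial solution vanishing at `θ`. -/
lemma exists_polynomial_solution {σ : Type*} [Fintype σ] (b : σ → k)
    (c : σ → RatFunc k) (u : RatFunc k)
    (hc : ∀ i, mapRatFunc φ (c i) = c i)
    (hu : mapRatFunc φ u = algebraMap _ _ (twistPoly φ θ) *
      (u + ∑ i, algebraMap _ _ (Polynomial.C (b i)) * c i)) :
    ∃ (D : Polynomial k) (d : σ → Polynomial Fq) (N : Polynomial k), D ≠ 0 ∧
      (∀ i, algebraMap _ _ D * c i = algebraMap _ _ ((d i).map const)) ∧
      algebraMap _ _ D * u = algebraMap _ _ N ∧ N.eval θ = 0 := by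
  classical
  have hinj := IsFractionRing.injective (Polynomial k) (RatFunc k)
  have hne : ∀ e : RatFunc k, algebraMap (Polynomial k) (RatFunc k) e.denom ≠ 0 :=
    fun e => by simpa using e.denom_ne_zero
  have hden : ∀ e : RatFunc k, algebraMap _ _ e.denom * e = algebraMap _ _ e.num := fun e => by
    conv_lhs => rw [← RatFunc.num_div_denom e, RatFunc.num_div_denom e, mul_comm]
    rw [← eq_div_iff (hne e), RatFunc.num_div_denom]
  set D₁ : Polynomial k := ∏ i, (c i).denom with hD₁
  have hD₁0 : D₁ ≠ 0 := Finset.prod_ne_zero_iff.mpr fun i _ => (c i).denom_ne_zero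
  have hD₁φ : D₁.map φ = D₁ := by
    rw [hD₁, Polynomial.map_prod]
    refine Finset.prod_congr rfl fun i _ => map_denom_eq φ (c i) 1 0 ?_
    rw [hc, map_one, map_zero, one_mul, add_zero]
  have hd₁ : ∀ i, ∃ d, algebraMap _ _ D₁ * c i =
      algebraMap (Polynomial k) (RatFunc k) d := fun i => by
    obtain ⟨e, he⟩ := Finset.dvd_prod_of_mem (fun i => (c i).denom) (Finset.mem_univ i)
    refine ⟨e * (c i).num, ?_⟩
    rw [hD₁, he, map_mul, map_mul, ← hden, mul_comm (algebraMap _ _ _) (algebraMap _ _ e), mul_assoc]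
  choose d₁ hd₁ using hd₁
  set u₁ := algebraMap _ _ D₁ * u with hu₁
  have hu₁φ : mapRatFunc φ u₁ = algebraMap _ _ (twistPoly φ θ) * u₁ +
      algebraMap _ _ (twistPoly φ θ * ∑ i, Polynomial.C (b i) * d₁ i) := by
    have h1 : algebraMap _ _ D₁ * ∑ i, algebraMap _ _ (Polynomial.C (b i)) * c i =
        algebraMap _ (RatFunc k) (∑ i, Polynomial.C (b i) * d₁ i) := by
      rw [map_sum, Finset.mul_sum]
      refine Finset.sum_congr rfl fun i _ => ?_
      rw [map_mul, ← hd₁, mul_left_comm]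
    rw [hu₁, map_mul, mapRatFunc_algebraMap, hD₁φ, hu, map_mul _ (twistPoly φ θ), ← h1]
    ring
  have hDφ := map_denom_eq φ u₁ _ _ hu₁φ
  set D := D₁ * u₁.denom with hD
  -- Both denominators are invariant, so the cleared coefficients stay invariant and descend to
  -- `𝔽_q`.
  have hd : ∀ i, ∃ d : Polynomial Fq, d.map const = u₁.denom * d₁ i := by
    intro i
    refine exists_polynomial_of_map_eq (const) φ hconst _ ?_
    apply hinj
    rw [← mapRatFunc_algebraMap, map_mul, ← hd₁, map_mul, map_mul, hc, mapRatFunc_algebraMap,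
      mapRatFunc_algebraMap, hD₁φ, hDφ]
  choose d hd using hd
  have hN : u₁.num.map φ = twistPoly φ θ * (u₁.num + ∑ i, Polynomial.C (b i) * (u₁.denom * d₁ i)) := by
    have hs : ∑ i, Polynomial.C (b i) * (u₁.denom * d₁ i) =
        u₁.denom * ∑ i, Polynomial.C (b i) * d₁ i := by
      rw [Finset.mul_sum]
      exact Finset.sum_congr rfl fun i _ => mul_left_comm _ _ _
    apply hinj
    rw [hs, ← mapRatFunc_algebraMap, ← hden, map_mul, mapRatFunc_algebraMap, hDφ, hu₁φ]
    simp only [map_mul, map_add, ← hden]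
    ring
  refine ⟨D, d, u₁.num, mul_ne_zero hD₁0 u₁.denom_ne_zero, fun i => ?_, ?_, ?_⟩
  · rw [hd, hD, map_mul, map_mul, ← hd₁]; ring
  · rw [← hden, hD, hu₁, map_mul]; ring
  · have h1 := congrArg (Polynomial.eval (φ θ)) hN
    rw [Polynomial.eval_map, Polynomial.eval₂_hom, Polynomial.eval_mul,
      Polynomial.eval_sub, Polynomial.eval_X, Polynomial.eval_C, sub_self,
      zero_mul, map_eq_zero] at h1
    exact h1

variable [Finite Fq] {L : Type*} [NormedField L] [IsUltrametricDist L] [Algebra k L] (ψ : L →+* L)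
  (hψ : ∀ z, ψ z = z → ∃ c, algebraMap k L (const c) = z)
  (hφψ : ∀ c, ψ (algebraMap k L c) = algebraMap k L (φ c))
  (p : ℕ) [Fact p.Prime] [CharP k p] (hk : ∀ z : k, ∃ w, w ^ p = z) {r : ℝ} (hr : 1 < r)

include hconst hψ hφψ hk in
/-- Algebraic dependence of bounded solutions of the difference equations comes from a linear relation whose coefficients
are polynomials over `𝔽_q` and whose constant term vanishes at `θ`. -/
theorem exists_polynomial_relation {σ : Type*} [Fintype σ] (X : σ → PowerSeries L)
    (hX : ∀ i, X i ∈ boundedSeries L r (zero_lt_one.trans hr)) (b : σ → k)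
    (hXb : ∀ i, PowerSeries.map ψ (X i) =
      (PowerSeries.X - PowerSeries.C (algebraMap k L (φ θ))) *
        (X i - PowerSeries.C (algebraMap k L (b i))))
    (o : σ) (hbo : b o = 0) (hXo : X o ≠ 0)
    (w : PowerSeries L) (hw : w ∈ boundedSeries L r (zero_lt_one.trans hr))
    (hwo : w * X o = 1)
    (hdep : ∃ P : MvPolynomial σ (RatFunc k), P ≠ 0 ∧
      P.eval₂ (ratToLaurent k L) (fun i => HahnSeries.ofPowerSeries ℤ L (X i)) = 0) :
    ∃ (d : σ → Polynomial Fq) (N : Polynomial k), (∃ i, d i ≠ 0) ∧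
      ∑ i, polyToSeries k L ((d i).map const) * X i +
        polyToSeries k L N = 0 ∧ N.eval θ = 0 := by
  classical
  set j := ratToLaurent k L with hj
  set x : σ → LaurentSeries L := fun i => HahnSeries.ofPowerSeries ℤ L (X i)
    with hx
  have hinj : Function.Injective (HahnSeries.ofPowerSeries ℤ L) :=
    HahnSeries.ofPowerSeries_injective
  have hfix := exists_ratToLaurent_eq_of_mapLaurent_eq const ψ hψ
    hr X hX (X o) w hw hwo
  have hcomm : ∀ e, mapLaurent ψ (j e) = j (mapRatFunc φ e) :=
    mapLaurent_ratToLaurent φ ψ hφψ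
  set a : RatFunc k := algebraMap _ _ (twistPoly φ θ) with ha
  set B : σ → RatFunc k := fun i => algebraMap _ _ (Polynomial.C (b i)) with hB
  have hxeq : ∀ i, mapLaurent ψ (x i) = j a * (x i - j (B i)) := by
    intro i
    change mapLaurent ψ (HahnSeries.ofPowerSeries ℤ L (X i)) =
      j a * (HahnSeries.ofPowerSeries ℤ L (X i) - j (algebraMap _ _ (Polynomial.C (b i))))
    rw [mapLaurent_coe, hXb, ha, hj, ratToLaurent_algebraMap, ratToLaurent_algebraMap, map_sub _ _
      (Polynomial.C (φ θ)), polyToSeries_X, polyToSeries_C, polyToSeries_C, ← map_sub, ← map_mul]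
  have ha0 : a ≠ 0 := by
    have : twistPoly φ θ ≠ 0 := Polynomial.X_sub_C_ne_zero _
    exact (map_ne_zero_iff _ (IsFractionRing.injective (Polynomial k) (RatFunc k))).mpr this
  have hBo : B o = 0 := by simp [hB, hbo]
  have hxo : x o ≠ 0 := (map_ne_zero_iff _ hinj).mpr hXo
  have hp : p.Prime := Fact.out
  have : CharP (RatFunc k) p :=
    charP_of_injective_ringHom (algebraMap k (RatFunc k)).injective p
  have : CharP (LaurentSeries L) p := charP_of_injective_ringHom j.injective p
  have hjX : j RatFunc.X = (HahnSeries.single 1 1 : LaurentSeries L) := by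
    rw [← RatFunc.algebraMap_X, hj, ratToLaurent_algebraMap, polyToSeries_X,
      HahnSeries.ofPowerSeries_X]
  obtain ⟨c, u, ⟨i₀, hi₀, hci₀⟩, hc, hu⟩ := exists_linear_relation j x (mapRatFunc φ)
    (mapLaurent ψ) hcomm a B hxeq p RatFunc.X
    (RatFunc_eq_sum_X_pow_mul_pow _ hk)
    (fun v hv => eq_zero_of_sum_pow_mul_pow_eq_zero _ (j RatFunc.X)
      (by rw [hjX]; exact pow_ne_single_one _ hp) v hv)
    ha0 o hBo hxo (fun g n P hg hP => hfix g hg n P hP)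
    (fun u n hn h => eq_zero_of_mapRatFunc_eq_pow_mul φ (twistPoly φ θ)
      (by rw [Polynomial.natDegree_X_sub_C]; exact one_pos) u n hn h)
    hdep
  -- The equation for `u` cancels the inhomogeneous terms, so `Y` solves the same equation as `x o`,
  -- and `Y / x o` is invariant.
  set Y := ∑ i, j (c i) * x i + j u with hY
  have hτY : mapLaurent ψ Y = j a * Y := by
    rw [hY, map_add, map_sum, hcomm, hu, map_mul, map_add, map_sum, mul_add, mul_add,
      Finset.mul_sum]
    simp only [map_mul, hcomm, hc, hxeq]
    rw [Finset.mul_sum, add_comm (j a * j u), ← add_assoc, ← Finset.sum_add_distrib]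
    congr 1
    exact Finset.sum_congr rfl fun i _ => by ring
  have hτo : mapLaurent ψ (x o) = j a * x o := by rw [hxeq, hBo, map_zero, sub_zero]
  have hja : j a ≠ 0 := (map_ne_zero j).mpr ha0
  have hτg : mapLaurent ψ (Y / x o) = Y / x o := by
    rw [map_div₀, hτY, hτo, mul_div_mul_left _ _ hja]
  obtain ⟨e, he⟩ := hfix (Y / x o) hτg 1
    (∑ i, MvPolynomial.C (c i) * MvPolynomial.X i + MvPolynomial.C u) (by
      rw [pow_one, div_mul_cancel₀ _ hxo, MvPolynomial.eval₂_add, MvPolynomial.eval₂_sum,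
        MvPolynomial.eval₂_C]
      simp only [MvPolynomial.eval₂_mul, MvPolynomial.eval₂_C, MvPolynomial.eval₂_X]
      rfl)
  have heφ : mapRatFunc φ e = e := by
    apply j.injective
    rw [← hcomm, hj, he, hτg]
  -- Subtracting `e` at `o` makes the combination vanish. Since `b o = 0`, the equation for `u` is
  -- unaffected, and the nonzero coefficient at `i₀ ≠ o` survives.
  set c' : σ → RatFunc k := fun i => c i - if i = o then e else 0 with hc'
  have hc'φ : ∀ i, mapRatFunc φ (c' i) = c' i := by
    intro i
    change mapRatFunc φ (c i - if i = o then e else 0) = c i - if i = o then e else 0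
    rw [map_sub, hc]
    split_ifs
    · rw [heφ]
    · rw [map_zero]
  have hBc : ∑ i, B i * c' i = ∑ i, B i * c i := by
    refine Finset.sum_congr rfl fun i _ => ?_
    by_cases hi : i = o
    · rw [hi, hBo, zero_mul, zero_mul]
    · simp [hc', hi]
  have hrel : ∑ i, j (c' i) * x i + j u = 0 := by
    have h1 : ∑ i, j (c' i) * x i = ∑ i, j (c i) * x i - j e * x o := by
      simp only [hc', map_sub, sub_mul, Finset.sum_sub_distrib, apply_ite j, map_zero, ite_mul,
        zero_mul, Finset.sum_ite_eq', Finset.mem_univ, if_true]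
    have h2 : j e * x o = Y := by rw [hj, he, div_mul_cancel₀ _ hxo]
    rw [h1, h2, hY]
    ring
  obtain ⟨D, d, N, hD0, hd, hN, hNθ⟩ := exists_polynomial_solution const φ hconst θ b c' u hc'φ
    (by rw [hu, ← hBc])
  have hD0' : (algebraMap (Polynomial k) (RatFunc k)) D ≠ 0 := by simpa using hD0
  refine ⟨d, N, ⟨i₀, fun h0 => ?_⟩, ?_, hNθ⟩
  · have h1 := hd i₀
    rw [h0, Polynomial.map_zero, map_zero, mul_eq_zero, hc'] at h1
    simp only [if_neg hi₀, sub_zero] at h1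
    exact h1.elim hD0' hci₀
  · apply hinj
    rw [map_zero, map_add, map_sum, ← ratToLaurent_algebraMap, ← hN, map_mul]
    simp only [map_mul, ← ratToLaurent_algebraMap, ← hd]
    have h1 := congrArg (fun z => j (algebraMap _ _ D) * z) hrel
    simp only [mul_zero, mul_add, Finset.mul_sum, ← mul_assoc] at h1
    exact h1

end AbstractRelation

/-! ### Specialisation to `K^alg` and `C((t))`. -/

section LinearRelation

variable (Fq : Type*) [Field Fq] [Fintype Fq]

/-- The constants `𝔽_q` in `K^alg`. -/
noncomputable def constKalg : Fq →+* Kalg Fq :=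
  (algebraMap (K Fq) (Kalg Fq)).comp (algebraMap Fq (K Fq))

/-- The element `θ` of `K^alg`. -/
noncomputable def thetaKalg : Kalg Fq := algebraMap (K Fq) (Kalg Fq) RatFunc.X

lemma coe_thetaKalg : algebraMap (Kalg Fq) (Cinfty Fq) (thetaKalg Fq) = theta Fq := rfl

lemma one_lt_radius : 1 < radius Fq :=
  one_lt_pow₀ (one_lt_q_real Fq) (by have := one_lt_q Fq; omega)

variable {Fq}

/-- The image of the embedding of rational functions is a field containing `K^alg` and `t`. This
lets relations over `KalgT` be lifted to abstract rational functions. -/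
lemma KalgT_le_range (z : KalgT Fq) :
    ∃ e, ratToLaurent (Kalg Fq) (Cinfty Fq) e = (z : LaurentSeries (Cinfty Fq)) := by
  let jA : RatFunc (Kalg Fq) →ₐ[Kalg Fq] LaurentSeries (Cinfty Fq) :=
    { ratToLaurent (Kalg Fq) (Cinfty Fq) with
      commutes' := fun c => by
        change ratToLaurent (Kalg Fq) (Cinfty Fq) (algebraMap _ _ c) = _
        rw [algebraMap_Kalg_laurentSeries, IsScalarTower.algebraMap_apply (Kalg Fq)
          (Polynomial (Kalg Fq)) (RatFunc (Kalg Fq)), ratToLaurent_algebraMap]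
        change HahnSeries.ofPowerSeries ℤ _ (polyToSeries _ _ (Polynomial.C c)) = _
        rw [polyToSeries_C, HahnSeries.ofPowerSeries_C]
        rfl }
  have hle : KalgT Fq ≤ jA.fieldRange := by
    rw [IntermediateField.adjoin_simple_le_iff]
    refine ⟨algebraMap _ _ (Polynomial.X : Polynomial (Kalg Fq)), ?_⟩
    change ratToLaurent (Kalg Fq) (Cinfty Fq)
      (algebraMap _ _ (Polynomial.X : Polynomial (Kalg Fq))) = _
    rw [ratToLaurent_algebraMap, polyToSeries_X, HahnSeries.ofPowerSeries_X]
  exact hle z.2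

lemma exists_relation_of_not_algebraicIndependent {σ : Type*}
    {x : σ → LaurentSeries (Cinfty Fq)} (h : ¬ AlgebraicIndependent (KalgT Fq) x) :
    ∃ P : MvPolynomial σ (RatFunc (Kalg Fq)), P ≠ 0 ∧
      P.eval₂ (ratToLaurent (Kalg Fq) (Cinfty Fq)) x = 0 := by
  rw [algebraicIndependent_iff] at h
  push Not at h
  obtain ⟨p, hp, hp0⟩ := h
  have h1 : p.map (algebraMap (KalgT Fq) (LaurentSeries (Cinfty Fq))) ∈
      (MvPolynomial.map (ratToLaurent (Kalg Fq) (Cinfty Fq)) :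
        MvPolynomial σ _ →+* MvPolynomial σ _).range := by
    refine MvPolynomial.mem_range_map_iff_coeffs_subset.mpr ?_
    intro z hz
    obtain ⟨μ, _, rfl⟩ := MvPolynomial.mem_coeffs_iff.mp hz
    rw [MvPolynomial.coeff_map]
    exact KalgT_le_range _
  obtain ⟨P, hP⟩ := h1
  refine ⟨P, ?_, ?_⟩
  · rintro rfl
    rw [map_zero] at hP
    exact hp0 ((MvPolynomial.map_injective _
      (algebraMap (KalgT Fq) (LaurentSeries (Cinfty Fq))).injective) (hP.symm.trans (map_zero _).symm))
  · rw [← MvPolynomial.eval_map, hP, MvPolynomial.eval_map, ← MvPolynomial.aeval_def]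
    exact hp

lemma qFrob_algebraMap_Kalg (c : Kalg Fq) : qFrob Fq (Cinfty Fq) (algebraMap _ _ c) =
    algebraMap (Kalg Fq) (Cinfty Fq) (qFrob Fq (Kalg Fq) c) := (map_pow _ _ _).symm

lemma exists_constKalg_eq (z : Kalg Fq) (hz : qFrob Fq (Kalg Fq) z = z) :
    ∃ c, constKalg Fq c = z := exists_algebraMap_eq_of_pow_q_eq z hz

lemma exists_constKalg_eq_coe (z : Cinfty Fq) (hz : qFrob Fq (Cinfty Fq) z = z) :
    ∃ c, algebraMap (Kalg Fq) (Cinfty Fq) (constKalg Fq c) = z :=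
  exists_algebraMap_eq_of_pow_q_eq z hz

instance : CharP (Kalg Fq) (ringChar Fq) :=
  charP_of_injective_ringHom (constKalg Fq).injective _

lemma evalSeries_polyToSeries_map (P : Polynomial Fq) :
    evalSeries (theta Fq) (polyToSeries (Kalg Fq) (Cinfty Fq) (P.map (constKalg Fq))) =
      algebraMap (K Fq) (Cinfty Fq) (algebraMap (Polynomial Fq) (K Fq) P) := by
  rw [polyToSeries_apply, evalSeries_coe, Polynomial.map_map, Polynomial.eval_map]
  change Polynomial.eval₂RingHom _ _ P = ((algebraMap (K Fq) (Cinfty Fq)).comp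
    (algebraMap (Polynomial Fq) (K Fq))) P
  congr 1
  refine Polynomial.ringHom_ext (fun c => ?_) ?_
  · simp only [Polynomial.coe_eval₂RingHom, Polynomial.eval₂_C, RingHom.comp_apply,
      RatFunc.algebraMap_C]
    rfl
  · simp only [Polynomial.coe_eval₂RingHom, Polynomial.eval₂_X, RingHom.comp_apply,
      RatFunc.algebraMap_X]
    rfl

end LinearRelation

end Carlitz

theorem mainTheorem9 (Fq : Type*) [Field Fq] [Fintype Fq]
    (ζ : Carlitz.Cinfty Fq) (hζ : ζ ^ (Carlitz.q Fq - 1) = -Carlitz.theta Fq)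
    (m : ℕ) (β : Fin m → Carlitz.Cinfty Fq)
    (hβ_alg : ∀ i, IsAlgebraic (Carlitz.K Fq) (β i))
    (hβ_norm : ∀ i, ‖β i‖ <
      (Carlitz.q Fq : ℝ) ^ ((Carlitz.q Fq : ℝ) / ((Carlitz.q Fq : ℝ) - 1)))
    (hdep : ¬ AlgebraicIndependent (Carlitz.KalgT Fq)
      (Fin.cons (Carlitz.Lzero ζ : LaurentSeries (Carlitz.Cinfty Fq))
        (fun i => (Carlitz.Lser (β i) : LaurentSeries (Carlitz.Cinfty Fq))) :
          Fin (m + 1) → LaurentSeries (Carlitz.Cinfty Fq))) :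
    ¬ LinearIndependent (Carlitz.K Fq)
      (Fin.cons (Carlitz.piTilde ζ) (fun i => Carlitz.logCar (β i)) :
        Fin (m + 1) → Carlitz.Cinfty Fq) := by
  let X : Fin (m + 1) → PowerSeries (Carlitz.Cinfty Fq) :=
    Fin.cons (Carlitz.Lzero ζ) fun i => Carlitz.Lser (β i)
  let b : Fin (m + 1) → Carlitz.Kalg Fq :=
    Fin.cons 0 fun i => ⟨β i, mem_algebraicClosure_iff.mpr (hβ_alg i)⟩
  have hX : ∀ i, X i ∈ Carlitz.boundedSeries (Carlitz.Cinfty Fq) (Carlitz.radius Fq)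
      (Carlitz.radius_pos Fq) := by
    refine Fin.cases ?_ fun i => ?_
    · exact Carlitz.gaussBound_Lzero ζ
    · exact ⟨_, Carlitz.gaussBound_Lser (hβ_norm i)⟩
  have hXb : ∀ i, PowerSeries.map (Carlitz.qFrob Fq (Carlitz.Cinfty Fq)) (X i) =
      (PowerSeries.X - PowerSeries.C (algebraMap (Carlitz.Kalg Fq) (Carlitz.Cinfty Fq)
        (Carlitz.qFrob Fq (Carlitz.Kalg Fq) (Carlitz.thetaKalg Fq)))) *
        (X i - PowerSeries.C (algebraMap (Carlitz.Kalg Fq) (Carlitz.Cinfty Fq) (b i))) := by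
    rw [← Carlitz.qFrob_algebraMap_Kalg, Carlitz.coe_thetaKalg]
    refine Fin.cases ?_ fun i => ?_
    · change _ = _ * (Carlitz.Lzero ζ - PowerSeries.C (algebraMap _ _ 0))
      rw [map_zero, map_zero, sub_zero]
      exact Carlitz.map_qFrob_Lzero hζ
    · exact Carlitz.map_qFrob_Lser (hβ_norm i)
  have hcons : (Fin.cons (Carlitz.Lzero ζ : LaurentSeries (Carlitz.Cinfty Fq))
      (fun i => (Carlitz.Lser (β i) : LaurentSeries (Carlitz.Cinfty Fq))) :
        Fin (m + 1) → LaurentSeries (Carlitz.Cinfty Fq)) =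
      fun i => HahnSeries.ofPowerSeries ℤ (Carlitz.Cinfty Fq) (X i) := by
    funext i
    refine Fin.cases ?_ (fun i => ?_) i <;> rfl
  rw [hcons] at hdep
  -- This is the bounded inverse of `L_0` needed to show that invariants are rational.
  have hw : -Carlitz.Omega ζ ∈ Carlitz.boundedSeries (Carlitz.Cinfty Fq) (Carlitz.radius Fq)
      (Carlitz.radius_pos Fq) := neg_mem (Carlitz.gaussBound_Omega ζ)
  obtain ⟨d, N, ⟨i₀, hi₀⟩, hrel, hN⟩ := Carlitz.exists_polynomial_relation
    (Carlitz.constKalg Fq) (Carlitz.qFrob Fq (Carlitz.Kalg Fq)) Carlitz.exists_constKalg_eq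
    (Carlitz.thetaKalg Fq) (Carlitz.qFrob Fq (Carlitz.Cinfty Fq)) Carlitz.exists_constKalg_eq_coe
    Carlitz.qFrob_algebraMap_Kalg (ringChar Fq)
    (Carlitz.exists_pow_eq_Kalg (Fact.out : (ringChar Fq).Prime).pos) (Carlitz.one_lt_radius Fq)
    X hX b hXb 0 rfl (Carlitz.Lzero_ne_zero hζ) (-Carlitz.Omega ζ) hw
    (by change -Carlitz.Omega ζ * Carlitz.Lzero ζ = 1
        rw [neg_mul, Carlitz.Omega_mul_Lzero hζ, neg_neg])
    (Carlitz.exists_relation_of_not_algebraicIndependent hdep)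
  let ev := Carlitz.evalSeriesHom (Carlitz.radius Fq) (Carlitz.radius_pos Fq) (Carlitz.theta Fq)
    (Carlitz.norm_theta_lt_radius Fq)
  have hpoly : ∀ P, Carlitz.polyToSeries (Carlitz.Kalg Fq) (Carlitz.Cinfty Fq) P ∈
      Carlitz.boundedSeries (Carlitz.Cinfty Fq) (Carlitz.radius Fq) (Carlitz.radius_pos Fq) :=
    fun P => Carlitz.coe_polynomial_mem_boundedSeries _ _
  have hrel' : ∑ i, (⟨_, hpoly ((d i).map (Carlitz.constKalg Fq))⟩ *
      ⟨X i, hX i⟩ : Carlitz.boundedSeries (Carlitz.Cinfty Fq) (Carlitz.radius Fq)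
        (Carlitz.radius_pos Fq)) + ⟨_, hpoly N⟩ = 0 := by
    apply Subtype.ext
    push_cast
    exact hrel
  have h1 := congrArg ev hrel'
  rw [map_add, map_sum, map_zero] at h1
  have hevN : ev ⟨_, hpoly N⟩ = 0 := by
    change Carlitz.evalSeries _ (Carlitz.polyToSeries _ _ N) = 0
    rw [Carlitz.polyToSeries_apply, Carlitz.evalSeries_coe, ← Carlitz.coe_thetaKalg,
      Polynomial.eval_map, Polynomial.eval₂_hom, hN, map_zero]
  have hevX : ∀ i, ev ⟨X i, hX i⟩ = (Fin.cons (Carlitz.piTilde ζ) (fun i => Carlitz.logCar (β i)) :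
      Fin (m + 1) → Carlitz.Cinfty Fq) i := by
    refine Fin.cases ?_ fun i => ?_
    · exact Carlitz.evalSeries_Lzero hζ
    · exact Carlitz.evalSeries_Lser (hβ_norm i)
  rw [hevN, add_zero] at h1
  rw [Fintype.not_linearIndependent_iff]
  refine ⟨fun i => algebraMap (Polynomial Fq) (Carlitz.K Fq) (d i), ?_, i₀, ?_⟩
  · rw [← h1]
    refine Finset.sum_congr rfl fun i _ => ?_
    rw [map_mul, hevX, Algebra.smul_def]
    congr 1
    exact (Carlitz.evalSeries_polyToSeries_map (d i)).symm
  -- Since `θ` is transcendental over `𝔽_q`, a nonzero `d i₀` stays nonzero at `t = θ`.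
  · exact (map_ne_zero_iff _ (IsFractionRing.injective (Polynomial Fq) (RatFunc Fq))).mpr hi₀
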